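/- For a connected undirected unweighted simple graph $G=(V,E_G)$, a $k$-spanner of $G$ is a subgraph $H=(V,E_H)$, $E_H\subseteq E_G$, with $\mathrm{dist}_H(u,v)\le k\cdot \mathrm{dist}_G(u,v)$ for all $u,v\in V$. The girth of a graph is the length of its smallest cycle ($\infty$ if there is none). A pair $(n,k)\in\mathbb N^2$ is $(\alpha,\beta)$-approx good if every connected $n$-vertex graph $G$ has a $k$-spanner $R=(V,E_R)$ of girth at least $k+2$ with $|E_R|-n\le\alpha(\mathrm{OPT}-n)+\beta$, where $\mathrm{OPT}$ is the minimum number of edges of a $k$-spanner of $G$. There are constants $C\in\mathbb R$ and $N\in\mathbb N$ such that the following hold. (1) There is a deterministic algorithm $A$, whose running time on every input $(G,H,k)$ with $G,H$ graphs on $n$ vertices is at most a fixed polynomial in $n$ (on a random access machine with addition and subtraction, the graphs being given by adjacency matrices), such that for all $n\ge N$, all integers $k>\frac47 n+C$, every connected $n$-vertex graph $G$ and every $k$-spanner $H=(V,E_H)$ of $G$, the output $R=(V,E_R)$ of $A(G,H,k)$ is a $k$-spanner of $G$ of girth at least $k+2$ with $$|E_R|-n\le 2(|E_H|-n)+1 .$$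 Moreover, $R$ is obtained from $H$ by a finite sequence (possibly empty) of iterations, each of which removes from the current $k$-spanner one edge of a smallest cycle, this cycle having length at most $k+1$, and adds at most two new edges of $G$, in such a way that the resulting graph is again a $k$-spanner of $G$ and none of the added edges lies on a cycle of length at most $k+1$ in it. (2) There is a constant $\beta\ge 0$ such that for all $n\ge N$ and all integers $k>\frac47 n+C$ the pair $(n,k)$ is $(2,\beta)$-approx good. -/

import Mathlib

/-! ### Spanners -/

/-- `H` is a `k`-spanner of `G`: a subgraph of `G` on the same vertices in which every distance
is at most `k` times the distance in `G`. -/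
def IsSpanner {V : Type*} (k : ℕ) (G H : SimpleGraph V) : Prop :=
  H ≤ G ∧ ∀ u v : V, H.edist u v ≤ (k : ℕ∞) * G.edist u v

/-- `M` is a `k`-spanner of `G` with the fewest edges. -/
def IsMinSpanner {V : Type*} (k : ℕ) (G M : SimpleGraph V) : Prop :=
  IsSpanner k G M ∧ ∀ M' : SimpleGraph V, IsSpanner k G M' → M.edgeSet.ncard ≤ M'.edgeSet.ncard

/-- The pair `(n, k)` is `(α, β)`-approx good: every connected `n`-vertex graph `G` has a
`k`-spanner `R` of girth at least `k + 2` with `|E_R| - n ≤ α (OPT - n) + β`, where `OPT` is the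
number of edges of any minimum `k`-spanner of `G`. -/
def ApproxGood (n k : ℕ) (α β : ℝ) : Prop :=
  ∀ G : SimpleGraph (Fin n), G.Connected →
    ∃ R : SimpleGraph (Fin n), IsSpanner k G R ∧ ((k + 2 : ℕ) : ℕ∞) ≤ R.egirth ∧
      ∀ M : SimpleGraph (Fin n), IsMinSpanner k G M →
        (R.edgeSet.ncard : ℝ) - n ≤ α * ((M.edgeSet.ncard : ℝ) - n) + β

/-- One iteration turning the subgraph `H` of `G` into `H'`: an edge `e` of a smallest cycle of `H`
(of length at most `k + 1`) is removed and a set `F` of at most two new edges of `G` is added,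
such that `H'` is a `k`-spanner of `G` and no added edge lies on a cycle of length at most `k + 1`
in `H'`. -/
def GirthStep {V : Type*} (k : ℕ) (G H H' : SimpleGraph V) : Prop :=
  ∃ (e : Sym2 V) (F : Finset (Sym2 V)),
    (∃ (x : V) (c : H.Walk x x), c.IsCycle ∧ (c.length : ℕ∞) = H.egirth ∧
      c.length ≤ k + 1 ∧ e ∈ c.edges) ∧
    F.card ≤ 2 ∧
    (F : Set (Sym2 V)) ⊆ G.edgeSet \ H.edgeSet ∧
    H' = H.deleteEdges {e} ⊔ SimpleGraph.fromEdgeSet (F : Set (Sym2 V)) ∧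
    IsSpanner k G H' ∧
    ∀ f ∈ F, ∀ (x : V) (c : H'.Walk x x), c.IsCycle → f ∈ c.edges → k + 1 < c.length

/-! ### A random access machine with a step count

Programs act on natural-number registers and natural-number matrices with random access. The only
arithmetic operations are addition and truncated subtraction, so that in `t` steps the bit length
of the stored numbers grows by `O(t)` only: polynomially many steps on this machine are the same as
polynomial time on a Turing machine. -/

namespace RAM

/-- The memory: register `x` holds `reg x`; entry `(i, j)` of matrix `A` holds `mat A i j`. -/
structure Memory where
  reg : ℕ → ℕ
  mat : ℕ → ℕ → ℕ → ℕ

/-- Expressions. Register and matrix names are fixed numbers; matrix indices are computed. -/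
inductive Expr : Type
  | lit (c : ℕ) : Expr
  | var (x : ℕ) : Expr
  | cell (A : ℕ) (i j : Expr) : Expr
  | add (e f : Expr) : Expr
  | sub (e f : Expr) : Expr

/-- The value of an expression; subtraction is truncated at `0`. -/
def Expr.val (s : Memory) : Expr → ℕ
  | lit c => c
  | var x => s.reg x
  | cell A i j => s.mat A (i.val s) (j.val s)
  | add e f => e.val s + f.val s
  | sub e f => e.val s - f.val s

/-- The number of steps needed to evaluate an expression: one for each of its nodes. -/
def Expr.cost : Expr → ℕ
  | lit _ => 1
  | var _ => 1
  | cell _ i j => i.cost + j.cost + 1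
  | add e f => e.cost + f.cost + 1
  | sub e f => e.cost + f.cost + 1

/-- Programs (finite texts). Tests ask whether an expression is nonzero;
`loop e p` repeats `p` as long as `e` is nonzero. -/
inductive Prog : Type
  | skip : Prog
  | assign (x : ℕ) (e : Expr) : Prog
  | store (A : ℕ) (i j e : Expr) : Prog
  | seq (p q : Prog) : Prog
  | ite (e : Expr) (p q : Prog) : Prog
  | loop (e : Expr) (p : Prog) : Prog

/-- The memory after writing `v` into register `x`. -/
def Memory.setReg (s : Memory) (x v : ℕ) : Memory :=
  { s with reg := fun y => if y = x then v else s.reg y }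

/-- The memory after writing `v` into entry `(i, j)` of matrix `A`. -/
def Memory.setMat (s : Memory) (A i j v : ℕ) : Memory :=
  { s with mat := fun B a b => if B = A ∧ a = i ∧ b = j then v else s.mat B a b }

/-- `Exec p s t s'`: started in memory `s`, the program `p` halts after exactly `t` steps with
memory `s'`. -/
inductive Exec : Prog → Memory → ℕ → Memory → Prop
  | skip (s : Memory) : Exec Prog.skip s 1 s
  | assign (x : ℕ) (e : Expr) (s : Memory) :
      Exec (Prog.assign x e) s (e.cost + 1) (s.setReg x (e.val s))
  | store (A : ℕ) (i j e : Expr) (s : Memory) :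
      Exec (Prog.store A i j e) s (i.cost + j.cost + e.cost + 1)
        (s.setMat A (i.val s) (j.val s) (e.val s))
  | seq {p q : Prog} {s s' s'' : Memory} {t t' : ℕ} :
      Exec p s t s' → Exec q s' t' s'' → Exec (Prog.seq p q) s (t + t') s''
  | ite_true {e : Expr} {p q : Prog} {s s' : Memory} {t : ℕ} :
      e.val s ≠ 0 → Exec p s t s' → Exec (Prog.ite e p q) s (e.cost + 1 + t) s'
  | ite_false {e : Expr} {p q : Prog} {s s' : Memory} {t : ℕ} :
      e.val s = 0 → Exec q s t s' → Exec (Prog.ite e p q) s (e.cost + 1 + t) s'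
  | loop_true {e : Expr} {p : Prog} {s s' s'' : Memory} {t t' : ℕ} :
      e.val s ≠ 0 → Exec p s t s' → Exec (Prog.loop e p) s' t' s'' →
        Exec (Prog.loop e p) s (e.cost + 1 + t + t') s''
  | loop_false {e : Expr} {p : Prog} {s : Memory} :
      e.val s = 0 → Exec (Prog.loop e p) s (e.cost + 1) s

/-- The machine is deterministic: step count and final memory are determined by the input. -/
theorem Exec.deterministic {p : Prog} {s s₁ s₂ : Memory} {t₁ t₂ : ℕ}
    (h₁ : Exec p s t₁ s₁) (h₂ : Exec p s t₂ s₂) : t₁ = t₂ ∧ s₁ = s₂ := by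
  induction h₁ generalizing t₂ s₂ with
  | skip s => cases h₂; exact ⟨rfl, rfl⟩
  | assign x e s => cases h₂; exact ⟨rfl, rfl⟩
  | store A i j e s => cases h₂; exact ⟨rfl, rfl⟩
  | seq _ _ ih ih' =>
    cases h₂ with
    | seq a b =>
      obtain ⟨rfl, rfl⟩ := ih a
      obtain ⟨rfl, rfl⟩ := ih' b
      exact ⟨rfl, rfl⟩
  | ite_true he _ ih =>
    cases h₂ with
    | ite_true _ a => obtain ⟨rfl, rfl⟩ := ih a; exact ⟨rfl, rfl⟩
    | ite_false h _ => exact absurd h he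
  | ite_false he _ ih =>
    cases h₂ with
    | ite_true h _ => exact absurd he h
    | ite_false _ a => obtain ⟨rfl, rfl⟩ := ih a; exact ⟨rfl, rfl⟩
  | loop_true he _ _ ih ih' =>
    cases h₂ with
    | loop_true _ a b =>
      obtain ⟨rfl, rfl⟩ := ih a
      obtain ⟨rfl, rfl⟩ := ih' b
      exact ⟨rfl, rfl⟩
    | loop_false h => exact absurd h he
  | loop_false he =>
    cases h₂ with
    | loop_true h _ _ => exact absurd he h
    | loop_false _ => exact ⟨rfl, rfl⟩

open Classical in
/-- The `0`-`1` adjacency matrix of a graph on `{0, …, n - 1}`, extended by zeros. -/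
noncomputable def adjacency {n : ℕ} (G : SimpleGraph (Fin n)) (i j : ℕ) : ℕ :=
  if ∃ u v : Fin n, (u : ℕ) = i ∧ (v : ℕ) = j ∧ G.Adj u v then 1 else 0

/-- The input memory for `(G, H, k)`: registers `0` and `1` hold `n` and `k`, matrices `0` and `1`
hold the adjacency matrices of `G` and `H`, and everything else is `0`. -/
noncomputable def input (n k : ℕ) (G H : SimpleGraph (Fin n)) : Memory where
  reg x := if x = 0 then n else if x = 1 then k else 0
  mat A i j := if A = 0 then adjacency G i j else if A = 1 then adjacency H i j else 0

/-- The memory `s` presents the output graph `R`: its adjacency matrix is in matrix `2`. -/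
def Outputs {n : ℕ} (s : Memory) (R : SimpleGraph (Fin n)) : Prop :=
  ∀ u v : Fin n, s.mat 2 u v = adjacency R u v

end RAM

/-! Delete an edge of a smallest cycle of length at most `k + 1`. The rest `T` is still connected;
repair it by greedily inserting edges of `G` whose ends are currently more than `k` apart. An
inserted edge lies on no cycle of length at most `k + 1`, since such a cycle, opened at that edge,
would have joined its ends by a walk of length at most `k`.

Two insertions always suffice (`Connected.dist_sup_edge_sup_edge_le`). Let `S` be a vertex set of
diameter at most `δ`, and let `x`, `y` be more than `k` apart. Shortest paths from `x` and `y` to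
`S`, disjoint outside `S`, contribute `q ≥ k + 1 - δ` new vertices, and once `xy` is inserted the
enlarged set has diameter at most `(q + 1) / 2 + δ` (`Connected.exists_ear`). Starting from a single
vertex, three such ears in succession need at least `7k/4 + 3/2` vertices, which is more than `n`
when `7k > 4n`.

Because inserted edges avoid short cycles, every deleted edge belongs to the initial spanner `H` and
closes a cycle of surviving edges of `H`. The surviving edges thus stay connected, so there are at
most `|E_H| - n + 1` iterations, each with a net gain of at most one edge
(`ncard_edgeSet_le_of_girthSteps`). This yields `|E_R| - n ≤ 2(|E_H| - n) + 1`.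

Short cycles only disappear, so one scan over the cycle lengths in increasing order and over all
pairs of vertices removes them all (`breakCycles_spec`). Each test in this scan is a distance
computation, carried out in polynomial time by layered search. -/

/-! ### Two long edges make a connected graph short -/

namespace SimpleGraph

variable {V : Type*}

/-- A shortest path, parametrized by the distance from its start. -/
theorem Connected.exists_geodesic {D : SimpleGraph V} (hD : D.Connected) (x a : V) :
    ∃ f : ℕ → V, f 0 = x ∧ f (D.dist x a) = a ∧
      ∀ i j, i ≤ j → j ≤ D.dist x a → D.dist (f i) (f j) = j - i := by
  obtain ⟨p, hp⟩ := hD.exists_walk_length_eq_dist x a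
  have hle : ∀ i j, i ≤ j → D.dist (p.getVert i) (p.getVert j) ≤ j - i := by
    intro i j hij
    have h1 : (p.drop i).getVert (j - i) = p.getVert j := by
      rw [Walk.drop_getVert]; congr 1; omega
    have h2 := (dist_le ((p.drop i).take (j - i))).trans_eq (Walk.take_length _ _)
    rw [h1] at h2
    omega
  refine ⟨p.getVert, by simp, by rw [← hp]; simp, fun i j hij hj => ?_⟩
  have h0 := hle 0 i (by omega)
  have h1 := hle i j hij
  have h2 := hle j (D.dist x a) hj
  have e0 : p.getVert 0 = x := by simp
  have e1 : p.getVert (D.dist x a) = a := by rw [← hp]; simp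
  rw [e0] at h0
  rw [e1] at h2
  -- Each of the three pieces is at most its index difference, and these add up to `D.dist x a`; by
  -- the triangle inequality all are equalities.
  have t1 := hD.dist_triangle (u := x) (v := p.getVert i) (w := a)
  have t2 := hD.dist_triangle (u := p.getVert i) (v := p.getVert j) (w := a)
  omega

/-- A shortest path from a vertex to a nonempty set of vertices. -/
theorem Connected.exists_geodesic_to_finset {D : SimpleGraph V} (hD : D.Connected)
    {S : Finset V} (hS : S.Nonempty) (x : V) :
    ∃ (r : ℕ) (f : ℕ → V), f 0 = x ∧ f r ∈ S ∧
      (∀ i j, i ≤ j → j ≤ r → D.dist (f i) (f j) = j - i) ∧ ∀ i < r, f i ∉ S := by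
  obtain ⟨a, ha, hmin⟩ := S.exists_min_image (D.dist x) hS
  obtain ⟨f, h0, h1, h2⟩ := hD.exists_geodesic x a
  refine ⟨D.dist x a, f, h0, by rwa [h1], h2, fun i hi hmem => ?_⟩
  have := hmin _ hmem
  have h3 := h2 0 i (by omega) hi.le
  rw [h0] at h3
  omega

theorem card_union_image_range [DecidableEq V] {S : Finset V} {f g : ℕ → V} {r s : ℕ}
    (hf : Set.InjOn f (Set.Iio r)) (hg : Set.InjOn g (Set.Iio s))
    (hfS : ∀ i < r, f i ∉ S) (hgS : ∀ i < s, g i ∉ S)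
    (hfg : ∀ i < r, ∀ j < s, f i ≠ g j) :
    (S ∪ (Finset.range r).image f ∪ (Finset.range s).image g).card = S.card + r + s := by
  rw [Finset.card_union_of_disjoint, Finset.card_union_of_disjoint, Finset.card_image_of_injOn,
    Finset.card_image_of_injOn, Finset.card_range, Finset.card_range]
  · simpa [Set.InjOn] using hg
  · simpa [Set.InjOn] using hf
  · rw [Finset.disjoint_right]
    simp only [Finset.mem_image, Finset.mem_range]
    rintro _ ⟨i, hi, rfl⟩
    exact hfS i hi
  · rw [Finset.disjoint_right]
    simp only [Finset.mem_image, Finset.mem_range, Finset.mem_union, not_or]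
    rintro _ ⟨i, hi, rfl⟩
    refine ⟨hgS i hi, ?_⟩
    rintro ⟨j, hj, h⟩
    exact hfg j hj i hi h

theorem injOn_of_dist {D : SimpleGraph V} {f : ℕ → V} {r : ℕ}
    (h : ∀ i j, i ≤ j → j ≤ r → D.dist (f i) (f j) = j - i) : Set.InjOn f (Set.Iio r) := by
  intro i hi j hj hij
  simp only [Set.mem_Iio] at hi hj
  rcases le_total i j with hl | hl
  · have := h i j hl hj.le
    rw [hij, dist_self] at this
    omega
  · have := h j i hl hi.le
    rw [hij, dist_self] at this
    omega

/-- Two shortest paths to `S` that meet outside `S` give a path avoiding `S`. -/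
theorem Connected.dist_add_card_le_of_meet [Fintype V] {D : SimpleGraph V} (hD : D.Connected)
    {S : Finset V} {f g : ℕ → V} {r s : ℕ}
    (hf : ∀ i j, i ≤ j → j ≤ r → D.dist (f i) (f j) = j - i)
    (hg : ∀ i j, i ≤ j → j ≤ s → D.dist (g i) (g j) = j - i)
    (hfS : ∀ i < r, f i ∉ S) (hgS : ∀ i < s, g i ∉ S)
    (hmeet : ∃ i, i < r ∧ ∃ j, j < s ∧ f i = g j) :
    D.dist (f 0) (g 0) + S.card < Fintype.card V := by
  classical
  obtain ⟨hi, j, hj, hij⟩ := Nat.find_spec hmeet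
  set i := Nat.find hmeet with hidef
  -- As `i` is the first index at which `f` meets `g`, the vertices before it on `f` and the first
  -- `j + 1` vertices of `g` are `i + j + 1` distinct vertices outside `S`, on a walk of length `i +
  -- j`.
  have hmin : ∀ i' < i, ∀ j' < j + 1, f i' ≠ g j' := fun i' hi' j' hj' h =>
    Nat.find_min hmeet hi' ⟨by omega, j', by omega, h⟩
  have hcard := card_union_image_range (S := S) (r := i) (s := j + 1) (f := f) (g := g)
    ((injOn_of_dist hf).mono (Set.Iio_subset_Iio hi.le))
    ((injOn_of_dist hg).mono (Set.Iio_subset_Iio hj))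
    (fun a ha => hfS a (by omega)) (fun a ha => hgS a (by omega)) hmin
  have hle := Finset.card_le_univ
    (S ∪ (Finset.range i).image f ∪ (Finset.range (j + 1)).image g)
  have t := hD.dist_triangle (u := f 0) (v := f i) (w := g 0)
  have t1 := hf 0 i (by omega) hi.le
  have t2 := hg 0 j (by omega) hj.le
  rw [hij] at t t1
  rw [dist_comm (u := g j)] at t
  omega

theorem dist_sup_edge_le_one (D : SimpleGraph V) (x y : V) : (D ⊔ edge x y).dist x y ≤ 1 := by
  rcases eq_or_ne x y with rfl | h
  · simp
  · refine (dist_eq_one_iff_adj.2 ?_).le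
    simp [edge_adj, h]

/-- Joining two vertices at distance more than `k` attaches a long ear to a set of small
diameter. -/
theorem Connected.exists_ear [Fintype V] {D : SimpleGraph V} (hD : D.Connected) {S : Finset V}
    {k d : ℕ} (hS : ∀ a ∈ S, ∀ b ∈ S, 2 * D.dist a b ≤ d) {x y : V}
    (hx : x ∈ S ∨ S.Nonempty ∧ Fintype.card V ≤ k + S.card) (hxy : k < D.dist x y) :
    ∃ (S' : Finset V) (q : ℕ), S'.card = S.card + q ∧ 2 * (k + 1) ≤ 2 * q + d ∧
      ∀ a ∈ S', ∀ b ∈ S', 2 * (D ⊔ edge x y).dist a b ≤ q + 1 + d := by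
  classical
  have hne : S.Nonempty := hx.elim (fun h => ⟨x, h⟩) And.left
  obtain ⟨r, f, hf0, hfr, hf, hfS⟩ := hD.exists_geodesic_to_finset hne x
  obtain ⟨s, g, hg0, hgs, hg, hgS⟩ := hD.exists_geodesic_to_finset hne y
  -- If `x ∈ S`, the first path has no vertex outside `S`. Otherwise a meeting point would put `x`
  -- and `y` at distance less than `n - |S| ≤ k`.
  have hfg : ∀ i < r, ∀ j < s, f i ≠ g j := by
    intro i hi j hj hij
    rcases hx with hx | ⟨-, hx⟩
    · exact hfS 0 (by omega) (hf0 ▸ hx)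
    · have := hD.dist_add_card_le_of_meet hf hg hfS hgS ⟨i, hi, j, hj, hij⟩
      rw [hf0, hg0] at this
      omega
  set D' := D ⊔ edge x y with hD'
  have hle : D ≤ D' := le_sup_left
  have hDc : D'.Connected := hD.mono hle
  have mono : ∀ a b, D'.dist a b ≤ D.dist a b := fun a b =>
    (hD.preconnected a b).dist_anti hle
  have tri : ∀ a b c, D'.dist a c ≤ D'.dist a b + D'.dist b c := fun a b c => hDc.dist_triangle
  have hone : D'.dist x y ≤ 1 := dist_sup_edge_le_one D x y
  have hS' : ∀ a ∈ S, ∀ b ∈ S, 2 * D'.dist a b ≤ d := fun a ha b hb =>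
    (Nat.mul_le_mul_left 2 (mono a b)).trans (hS a ha b hb)
  have hf' : ∀ i j, i ≤ j → j ≤ r → D'.dist (f i) (f j) ≤ j - i := fun i j h1 h2 =>
    (mono _ _).trans (hf i j h1 h2).le
  have hg' : ∀ i j, i ≤ j → j ≤ s → D'.dist (g i) (g j) ≤ j - i := fun i j h1 h2 =>
    (mono _ _).trans (hg i j h1 h2).le
  have hab := hS' _ hfr _ hgs
  refine ⟨S ∪ (Finset.range r).image f ∪ (Finset.range s).image g, r + s, ?_, ?_, ?_⟩
  · rw [card_union_image_range (injOn_of_dist hf) (injOn_of_dist hg) hfS hgS hfg, add_assoc]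
  · have t1 := hD.dist_triangle (u := x) (v := f r) (w := y)
    have t2 := hD.dist_triangle (u := f r) (v := g s) (w := y)
    have e1 := hf 0 r (by omega) le_rfl
    have e2 := hg 0 s (by omega) le_rfl
    have e3 := hS _ hfr _ hgs
    rw [hf0] at e1
    rw [hg0, dist_comm] at e2
    omega
  -- In each case below there are two routes between the vertices, one in each direction around the
  -- ear closed up through `S`. Their lengths add up to at most `r + s + 1 + d`, so twice the
  -- distance is at most that.
  · have key_fS : ∀ i < r, ∀ b ∈ S, 2 * D'.dist (f i) b ≤ r + s + 1 + d := by
      intro i hi b hb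
      have := tri (f i) (f r) b
      have := tri (f i) x b
      have := tri x y b
      have := tri y (g s) b
      have := hS' _ hfr b hb
      have := hS' _ hgs b hb
      have := hf' i r hi.le le_rfl
      have e := hf' 0 i (by omega) hi.le
      rw [hf0, dist_comm] at e
      have e' := hg' 0 s (by omega) le_rfl
      rw [hg0] at e'
      omega
    have key_gS : ∀ i < s, ∀ b ∈ S, 2 * D'.dist (g i) b ≤ r + s + 1 + d := by
      intro i hi b hb
      have := tri (g i) (g s) b
      have := tri (g i) y b
      have := tri y x b
      have := tri x (f r) b
      have := hS' _ hfr b hb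
      have := hS' _ hgs b hb
      have := hg' i s hi.le le_rfl
      have e := hg' 0 i (by omega) hi.le
      rw [hg0, dist_comm] at e
      have e' := hf' 0 r (by omega) le_rfl
      rw [hf0] at e'
      rw [dist_comm (u := x)] at hone
      omega
    have key_fg : ∀ i < r, ∀ j < s, 2 * D'.dist (f i) (g j) ≤ r + s + 1 + d := by
      intro i hi j hj
      have := tri (f i) (f r) (g j)
      have := tri (f r) (g s) (g j)
      have := tri (f i) x (g j)
      have := tri x y (g j)
      have := hf' i r hi.le le_rfl
      have e := hf' 0 i (by omega) hi.le
      rw [hf0, dist_comm] at e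
      have e1 := hg' j s hj.le le_rfl
      rw [dist_comm] at e1
      have e2 := hg' 0 j (by omega) hj.le
      rw [hg0] at e2
      omega
    have key_ff : ∀ i j, i ≤ j → j < r → 2 * D'.dist (f i) (f j) ≤ r + s + 1 + d := by
      intro i j hij hj
      have := hf' i j hij hj.le
      have := tri (f i) x (f j)
      have := tri x y (f j)
      have := tri y (g s) (f j)
      have := tri (g s) (f r) (f j)
      have e := hf' 0 i (by omega) (by omega)
      rw [hf0, dist_comm] at e
      have e1 := hf' j r hj.le le_rfl
      rw [dist_comm] at e1
      have e2 := hg' 0 s (by omega) le_rfl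
      rw [hg0] at e2
      rw [dist_comm] at hab
      omega
    have key_gg : ∀ i j, i ≤ j → j < s → 2 * D'.dist (g i) (g j) ≤ r + s + 1 + d := by
      intro i j hij hj
      have := hg' i j hij hj.le
      have := tri (g i) y (g j)
      have := tri y x (g j)
      have := tri x (f r) (g j)
      have := tri (f r) (g s) (g j)
      have e := hg' 0 i (by omega) (by omega)
      rw [hg0, dist_comm] at e
      have e1 := hg' j s hj.le le_rfl
      rw [dist_comm] at e1
      have e2 := hf' 0 r (by omega) le_rfl
      rw [hf0] at e2
      rw [dist_comm (u := x)] at hone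
      omega
    intro a ha b hb
    simp only [Finset.mem_union, Finset.mem_image, Finset.mem_range] at ha hb
    rcases ha with (ha | ⟨i, hi, rfl⟩) | ⟨i, hi, rfl⟩ <;>
      rcases hb with (hb | ⟨j, hj, rfl⟩) | ⟨j, hj, rfl⟩
    · exact (hS' a ha b hb).trans (by omega)
    · rw [dist_comm]; exact key_fS j hj a ha
    · rw [dist_comm]; exact key_gS j hj a ha
    · exact key_fS i hi b hb
    · rcases le_total i j with h | h
      · exact key_ff i j h hj
      · rw [dist_comm]; exact key_ff j i h hi
    · exact key_fg i hi j hj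
    · exact key_gS i hi b hb
    · rw [dist_comm]; exact key_fg j hj i hi
    · rcases le_total i j with h | h
      · exact key_gg i j h hj
      · rw [dist_comm]; exact key_gg j i h hi

/-- If `7 k > 4 n`, then adding to a connected graph on `n` vertices two edges, each between
vertices at distance more than `k` at that time, reduces the diameter to at most `k`. -/
theorem Connected.dist_sup_edge_sup_edge_le [Fintype V] {D : SimpleGraph V} (hD : D.Connected)
    {k : ℕ} (hk : 4 * Fintype.card V < 7 * k) {x₁ y₁ x₂ y₂ : V} (h₁ : k < D.dist x₁ y₁)
    (h₂ : k < (D ⊔ edge x₁ y₁).dist x₂ y₂) (x y : V) :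
    (D ⊔ edge x₁ y₁ ⊔ edge x₂ y₂).dist x y ≤ k := by
  by_contra! h₃
  have hD₁ : (D ⊔ edge x₁ y₁).Connected := hD.mono le_sup_left
  have hD₂ : (D ⊔ edge x₁ y₁ ⊔ edge x₂ y₂).Connected := hD₁.mono le_sup_left
  -- A singleton is too small for the cardinality alternative, so the first ear starts at its own
  -- vertex. Afterwards `|S₁| ≥ k + 2`, and `n < 7k/4` makes the cardinality alternative available.
  obtain ⟨S₁, q₁, c₁, l₁, d₁⟩ := hD.exists_ear (S := {x₁}) (d := 0) (by simp) (by simp) h₁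
  rw [Finset.card_singleton] at c₁
  obtain ⟨S₂, q₂, c₂, l₂, d₂⟩ := hD₁.exists_ear d₁
    (Or.inr ⟨Finset.card_pos.1 (by omega), by omega⟩) h₂
  obtain ⟨S₃, q₃, c₃, l₃, -⟩ := hD₂.exists_ear d₂
    (Or.inr ⟨Finset.card_pos.1 (by omega), by omega⟩) h₃
  -- Here `q₁ ≥ k + 1`, `2 q₂ + q₁ + 1 ≥ 2 (k + 1)` and `2 q₃ + q₁ + q₂ + 2 ≥ 2 (k + 1)`. Hence
  -- `|S₃| = 1 + q₁ + q₂ + q₃ ≥ 7k/4 + 3/2 > n`.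
  have := Finset.card_le_univ S₃
  omega

end SimpleGraph

/-! ### Cycles through an edge -/

namespace SimpleGraph

variable {V : Type*}

theorem Walk.exists_append_cons_of_mem_edges {G : SimpleGraph V} {a b : V} (p : G.Walk a b)
    {e : Sym2 V} (he : e ∈ p.edges) :
    ∃ (x y : V) (h : G.Adj x y) (q₁ : G.Walk a x) (q₂ : G.Walk y b),
      s(x, y) = e ∧ p = q₁.append (Walk.cons h q₂) := by
  induction p with
  | nil => simp at he
  | cons h p ih =>
    rw [Walk.edges_cons, List.mem_cons] at he
    rcases he with rfl | he
    · exact ⟨_, _, h, Walk.nil, p, rfl, rfl⟩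
    · obtain ⟨x, y, h', q₁, q₂, hxy, rfl⟩ := ih he
      exact ⟨x, y, h', Walk.cons h q₁, q₂, hxy, rfl⟩

/-- Opening a closed trail at one of its edges. -/
theorem Walk.IsTrail.exists_walk_of_mem_edges {G : SimpleGraph V} {a x y : V} {c : G.Walk a a}
    (hc : c.IsTrail) (he : s(x, y) ∈ c.edges) :
    ∃ q : G.Walk x y, q.length + 1 = c.length ∧ s(x, y) ∉ q.edges ∧ q.edges ⊆ c.edges := by
  obtain ⟨x', y', h, q₁, q₂, hxy, rfl⟩ := c.exists_append_cons_of_mem_edges he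
  have hnd := hc.edges_nodup
  rw [Walk.edges_append, Walk.edges_cons, List.nodup_middle, List.nodup_cons] at hnd
  have key : ∃ q : G.Walk y' x', q.length = q₂.length + q₁.length ∧
      q.edges = q₂.edges ++ q₁.edges := ⟨q₂.append q₁, by simp, by simp⟩
  obtain ⟨q, hl, hq⟩ := key
  have hmem : s(x', y') ∉ q.edges := by
    rw [hq]
    have := hnd.1
    simp only [List.mem_append] at this ⊢
    tauto
  have hsub : q.edges ⊆ (q₁.append (Walk.cons h q₂)).edges := by
    rw [hq]
    intro f hf
    simp only [Walk.edges_append, Walk.edges_cons, List.mem_append, List.mem_cons] at hf ⊢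
    tauto
  have hlen : q.length + 1 = (q₁.append (Walk.cons h q₂)).length := by
    rw [hl, Walk.length_append, Walk.length_cons]; omega
  rcases Sym2.eq_iff.1 hxy with ⟨rfl, rfl⟩ | ⟨rfl, rfl⟩
  · exact ⟨q.reverse, by simpa using hlen, by simpa using hmem, by simpa using hsub⟩
  · exact ⟨q, hlen, by rwa [Sym2.eq_swap], hsub⟩

/-- Together with the converse below, this replaces the search for a short cycle through an edge by
a distance test after deleting that edge. -/
theorem edist_deleteEdges_lt_of_mem_edges {G : SimpleGraph V} {a x y : V} {c : G.Walk a a}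
    (hc : c.IsCycle) (he : s(x, y) ∈ c.edges) {m : ℕ} (hm : c.length ≤ m + 1) :
    (G.deleteEdges {s(x, y)}).edist x y ≤ m := by
  obtain ⟨q, hl, hq, -⟩ := hc.isTrail.exists_walk_of_mem_edges he
  have := edist_le (q.toDeleteEdge s(x, y) hq)
  refine this.trans ?_
  simp only [Walk.toDeleteEdge, Walk.toDeleteEdges, Walk.length_transfer]
  exact_mod_cast (by omega)

theorem exists_isCycle_of_edist_deleteEdges_le {G : SimpleGraph V} {x y : V} (h : G.Adj x y)
    {m : ℕ} (hm : (G.deleteEdges {s(x, y)}).edist x y ≤ m) :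
    ∃ (a : V) (c : G.Walk a a), c.IsCycle ∧ c.length ≤ m + 1 ∧ s(x, y) ∈ c.edges := by
  classical
  obtain ⟨p, hp⟩ := exists_walk_of_edist_ne_top (ne_top_of_le_ne_top (ENat.natCast_ne_top m) hm)
  have hpm : p.length ≤ m := by rw [← hp] at hm; exact_mod_cast hm
  have hedge : ∀ f ∈ p.bypass.edges, f ∈ G.edgeSet ∧ f ≠ s(x, y) := by
    intro f hf
    simpa using p.bypass.edges_subset_edgeSet hf
  let q : G.Walk x y := p.bypass.transfer G fun f hf => (hedge f hf).1
  have hq : q.IsPath := p.bypass_isPath.transfer _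
  refine ⟨y, Walk.cons h.symm q, ?_, ?_, ?_⟩
  · rw [Walk.cons_isCycle_iff]
    refine ⟨hq, fun hmem => ?_⟩
    rw [Walk.edges_transfer] at hmem
    exact (hedge _ hmem).2 Sym2.eq_swap
  · have := p.length_bypass_le_length
    simp only [Walk.length_cons, q, Walk.length_transfer]
    omega
  · simp [Sym2.eq_swap]

theorem Connected.deleteEdges_of_mem_edges {G : SimpleGraph V} (hG : G.Connected) {a : V}
    {c : G.Walk a a} (hc : c.IsCycle) {e : Sym2 V} (he : e ∈ c.edges) :
    (G.deleteEdges {e}).Connected := by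
  induction e with | _ x y
  refine hG.connected_delete_edge_of_not_isBridge fun hb => ?_
  exact hb.notMem_edges_of_isCycle hc he

/-- A shorter cycle, opened at `xy`, would leave a walk of length at most `k` from `x` to `y` inside
`D`. -/
theorem lt_length_of_mem_edges_sup_edge {D : SimpleGraph V} {k : ℕ} {x y : V}
    (h : (k : ℕ∞) < D.edist x y) {a : V} {c : (D ⊔ edge x y).Walk a a} (hc : c.IsCycle)
    (he : s(x, y) ∈ c.edges) : k + 1 < c.length := by
  by_contra! hl
  have h1 := edist_deleteEdges_lt_of_mem_edges hc he hl
  have h2 : (D ⊔ edge x y).deleteEdges {s(x, y)} ≤ D := by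
    intro a b hab
    simp only [deleteEdges_adj, sup_adj, edge_adj, Set.mem_singleton_iff] at hab
    rcases hab.1 with h | ⟨⟨rfl, rfl⟩ | ⟨rfl, rfl⟩, -⟩
    · exact h
    · exact absurd rfl hab.2
    · exact absurd Sym2.eq_swap hab.2
  exact absurd (h.trans_le (edist_anti h2)) (not_lt.2 h1)

theorem Walk.IsCycle.length_le_card [Fintype V] {G : SimpleGraph V} {a : V} {c : G.Walk a a}
    (hc : c.IsCycle) : c.length ≤ Fintype.card V := by
  have := hc.support_nodup.length_le_card
  simpa using this

end SimpleGraph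

/-! ### Spanners and girth steps -/

-- The bound for edges adds up along a shortest walk of `G`. For pairs at infinite distance, `k ≠ 0`
-- keeps the right-hand side infinite.
open SimpleGraph in
theorem isSpanner_of_adj {V : Type*} {k : ℕ} (hk : k ≠ 0) {G R : SimpleGraph V} (hle : R ≤ G)
    (h : ∀ x y, G.Adj x y → R.edist x y ≤ k) : IsSpanner k G R := by
  refine ⟨hle, fun u v => ?_⟩
  by_cases huv : G.edist u v = ⊤
  · rw [huv, ENat.mul_top (by simpa using hk)]
    exact le_top
  · obtain ⟨p, hp⟩ := exists_walk_of_edist_ne_top huv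
    rw [← hp]
    clear hp huv
    induction p with
    | nil => simp
    | cons hadj p ih =>
      refine SimpleGraph.edist_triangle.trans ((add_le_add (h _ _ hadj) ih).trans_eq ?_)
      rw [Walk.length_cons]
      push_cast
      ring

open SimpleGraph in
theorem IsSpanner.connected {V : Type*} {k : ℕ} {G H : SimpleGraph V} (h : IsSpanner k G H)
    (hG : G.Connected) : H.Connected := by
  have := hG.nonempty
  refine ⟨fun u v => reachable_of_edist_ne_top (ne_top_of_le_ne_top ?_ (h.2 u v))⟩
  exact WithTop.mul_ne_top (ENat.natCast_ne_top k) (edist_ne_top_iff_reachable.2 (hG.preconnected u v))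

/-- All edges of `H` that lie on cycles of length at most `k + 1` belong to `O`. -/
def ShortCyclesIn {V : Type*} (k : ℕ) (H : SimpleGraph V) (O : Set (Sym2 V)) : Prop :=
  ∀ (x : V) (c : H.Walk x x), c.IsCycle → c.length ≤ k + 1 → ∀ f ∈ c.edges, f ∈ O

-- A short cycle of `H'` uses no edge of `F`, hence is already a cycle of `H`, and one that avoids
-- `e`.
open SimpleGraph in
theorem shortCyclesIn_of_sup_fromEdgeSet {V : Type*} {k : ℕ} {H H' : SimpleGraph V}
    {O : Set (Sym2 V)} (hH : ShortCyclesIn k H O) {e : Sym2 V} {F : Set (Sym2 V)}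
    (hH' : H' = H.deleteEdges {e} ⊔ fromEdgeSet F)
    (hF : ∀ f ∈ F, ∀ (x : V) (c : H'.Walk x x), c.IsCycle → f ∈ c.edges → k + 1 < c.length) :
    ShortCyclesIn k H' (O \ {e}) := by
  intro x c hc hl
  have hmem : ∀ f ∈ c.edges, f ∈ H.edgeSet ∧ f ≠ e := by
    intro f hf
    have h1 := c.edges_subset_edgeSet hf
    have h2 : f ∉ F := fun h => absurd (hF f h x c hc hf) (not_lt.2 hl)
    rw [hH', edgeSet_sup, edgeSet_deleteEdges, edgeSet_fromEdgeSet] at h1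
    rcases h1 with h1 | h1
    · exact ⟨h1.1, h1.2⟩
    · exact absurd h1.1 h2
  intro f hf
  exact ⟨hH x (c.transfer H fun f hf => (hmem f hf).1) (hc.transfer _)
    (by simpa using hl) f (by simpa using hf), (hmem f hf).2⟩

theorem shortCyclesIn_edgeSet {V : Type*} (k : ℕ) (H : SimpleGraph V) :
    ShortCyclesIn k H H.edgeSet := fun _ c _ _ _ hf => c.edges_subset_edgeSet hf

open SimpleGraph in
/-- Every girth step removes an original edge lying on a cycle of original edges, so there are at
most as many steps as the cyclomatic number of the initial graph. -/
theorem ncard_edgeSet_le_of_girthSteps {V : Type*} [Fintype V] {k : ℕ} {G H R : SimpleGraph V}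
    (hH : H.Connected) (h : Relation.ReflTransGen (GirthStep k G) H R) :
    R.edgeSet.ncard + Fintype.card V ≤ 2 * H.edgeSet.ncard + 1 := by
  -- `O` consists of the edges of `H` not yet deleted. Each step takes one edge from `O` and adds at
  -- most one to the balance of `R`, so the sum of the two edge counts never grows; connectedness of
  -- `O` bounds its count below by `|V| - 1`.
  have key : ∃ O : SimpleGraph V, O.Connected ∧ ShortCyclesIn k R O.edgeSet ∧
      R.edgeSet.ncard + O.edgeSet.ncard ≤ 2 * H.edgeSet.ncard := by
    induction h with
    | refl => exact ⟨H, hH, shortCyclesIn_edgeSet k H, by omega⟩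
    | @tail R R' _ hstep ih =>
      obtain ⟨O, hO, hsc, hcard⟩ := ih
      obtain ⟨e, F, ⟨x, c, hc, -, hl, he⟩, hF2, hFG, hR', -, hFl⟩ := hstep
      have hcO := hsc x c hc hl
      refine ⟨O.deleteEdges {e}, ?_, ?_, ?_⟩
      · exact hO.deleteEdges_of_mem_edges (c := c.transfer O hcO) (hc.transfer hcO) (by simpa)
      · rw [edgeSet_deleteEdges]
        exact shortCyclesIn_of_sup_fromEdgeSet hsc hR' hFl
      · have heR : e ∈ R.edgeSet := c.edges_subset_edgeSet he
        have heO : e ∈ O.edgeSet := hcO e he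
        have h1 : (O.edgeSet \ {e}).ncard + 1 = O.edgeSet.ncard :=
          Set.ncard_sdiff_singleton_add_one heO (Set.toFinite _)
        have h2 : (R.edgeSet \ {e}).ncard + 1 = R.edgeSet.ncard :=
          Set.ncard_sdiff_singleton_add_one heR (Set.toFinite _)
        have h3 : R'.edgeSet.ncard ≤ (R.edgeSet \ {e}).ncard + 2 := by
          rw [hR', edgeSet_sup, edgeSet_deleteEdges, edgeSet_fromEdgeSet]
          refine (Set.ncard_union_le _ _).trans (Nat.add_le_add_left ?_ _)
          refine (Set.ncard_le_ncard Set.sdiff_subset (F.finite_toSet)).trans ?_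
          rwa [Set.ncard_coe_finset]
        rw [edgeSet_deleteEdges]
        omega
  obtain ⟨O, hO, -, hcard⟩ := key
  have := hO.card_vert_le_card_edgeSet_add_one
  rw [Nat.card_eq_fintype_card, Nat.card_coe_set_eq] at this
  omega

/-! ### The algorithm on graphs -/

/-- The result of applying `f 0`, …, `f (m - 1)` in this order. -/
def iterUpTo {α : Type*} {n : ℕ} (f : Fin n → α → α) : ℕ → α → α
  | 0, a => a
  | m + 1, a => if h : m < n then f ⟨m, h⟩ (iterUpTo f m a) else iterUpTo f m a

theorem iterUpTo_succ {α : Type*} {n : ℕ} (f : Fin n → α → α) (i : Fin n) (a : α) :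
    iterUpTo f (i + 1) a = f i (iterUpTo f i a) := by
  simp [iterUpTo]

theorem iterUpTo_induction {α : Type*} {n : ℕ} {f : Fin n → α → α} {a : α}
    (P : ℕ → α → Prop) (h0 : P 0 a) (hs : ∀ (i : Fin n) b, P i b → P (i + 1) (f i b)) :
    P n (iterUpTo f n a) := by
  suffices ∀ m ≤ n, P m (iterUpTo f m a) from this n le_rfl
  intro m
  induction m with
  | zero => exact fun _ => h0
  | succ m ih =>
    intro hm
    rw [iterUpTo_succ f ⟨m, hm⟩]
    exact hs ⟨m, hm⟩ _ (ih (by omega))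

open Classical in
/-- Add the edge `xy` of `G` to `H` if its ends are at distance more than `k` in `H`. -/
noncomputable def addEdge {n : ℕ} (k : ℕ) (G : SimpleGraph (Fin n)) (x y : Fin n)
    (H : SimpleGraph (Fin n)) : SimpleGraph (Fin n) :=
  if G.Adj x y ∧ ¬ H.edist x y ≤ k then H ⊔ SimpleGraph.edge x y else H

/-- Process all edges of `G` greedily. -/
noncomputable def greedy {n : ℕ} (k : ℕ) (G H : SimpleGraph (Fin n)) : SimpleGraph (Fin n) :=
  iterUpTo (fun x => iterUpTo (fun y => addEdge k G x y) n) n H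

open Classical in
/-- Remove the edge `uv` from `H` if it lies on a cycle of length at most `L + 1 ≤ k + 1`, and
repair the spanner greedily. -/
noncomputable def breakCycle {n : ℕ} (k : ℕ) (G : SimpleGraph (Fin n)) (L u v : Fin n)
    (H : SimpleGraph (Fin n)) : SimpleGraph (Fin n) :=
  if H.Adj u v ∧ (L : ℕ) ≤ k ∧ (H.deleteEdges {s(u, v)}).edist u v ≤ ((L : ℕ) : ℕ∞) then
    greedy k G (H.deleteEdges {s(u, v)})
  else H

/-- Break all short cycles, the shortest first. -/
noncomputable def breakCycles {n : ℕ} (k : ℕ) (G H : SimpleGraph (Fin n)) :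
    SimpleGraph (Fin n) :=
  iterUpTo (fun L => iterUpTo (fun u => iterUpTo (fun v => breakCycle k G L u v) n) n) n H

/-! ### Repairing a spanner with at most two long edges -/

open SimpleGraph

/-- `R` arises from `T` by adding at most two edges of `G`, each between vertices at distance more
than `k` at that time. -/
def FewLongEdges {V : Type*} (k : ℕ) (G T R : SimpleGraph V) : Prop :=
  R = T ∨ (∃ x y, G.Adj x y ∧ (k : ℕ∞) < T.edist x y ∧ R = T ⊔ edge x y) ∨
    ∃ x₁ y₁ x₂ y₂, G.Adj x₁ y₁ ∧ G.Adj x₂ y₂ ∧ (k : ℕ∞) < T.edist x₁ y₁ ∧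
      (k : ℕ∞) < (T ⊔ edge x₁ y₁).edist x₂ y₂ ∧ R = T ⊔ edge x₁ y₁ ⊔ edge x₂ y₂

theorem SimpleGraph.Connected.lt_edist_iff {V : Type*} {D : SimpleGraph V} (hD : D.Connected)
    {k : ℕ} {x y : V} : (k : ℕ∞) < D.edist x y ↔ k < D.dist x y := by
  rw [← (hD.preconnected x y).coe_dist_eq_edist, Nat.cast_lt]

/-- A third insertion cannot occur: after two of them all distances are at most `k`. -/
theorem fewLongEdges_addEdge {n k : ℕ} (hk : 4 * n < 7 * k) {G T H : SimpleGraph (Fin n)}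
    (hT : T.Connected) (h : FewLongEdges k G T H) (x y : Fin n) :
    FewLongEdges k G T (addEdge k G x y H) := by
  rw [addEdge]
  split_ifs with hxy
  swap
  · exact h
  obtain ⟨hG, hd⟩ := hxy
  rw [not_le] at hd
  rcases h with rfl | ⟨a, b, hab, hd', rfl⟩ | ⟨a, b, c, d, -, -, h1, h2, rfl⟩
  · exact Or.inr (Or.inl ⟨x, y, hG, hd, rfl⟩)
  · exact Or.inr (Or.inr ⟨a, b, x, y, hab, hG, hd', hd, rfl⟩)
  · have hT₁ : (T ⊔ edge a b).Connected := hT.mono le_sup_left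
    have hT₂ : (T ⊔ edge a b ⊔ edge c d).Connected := hT₁.mono le_sup_left
    rw [hT.lt_edist_iff] at h1
    rw [hT₁.lt_edist_iff] at h2
    rw [hT₂.lt_edist_iff] at hd
    exact absurd hd (not_lt.2 (hT.dist_sup_edge_sup_edge_le (by simpa using hk) h1 h2 x y))

theorem le_addEdge {n k : ℕ} (G H : SimpleGraph (Fin n)) (x y : Fin n) :
    H ≤ addEdge k G x y H := by
  rw [addEdge]
  split_ifs
  · exact le_sup_left
  · exact le_rfl

theorem edist_addEdge_le {n k : ℕ} (hk : k ≠ 0) {G : SimpleGraph (Fin n)}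
    (H : SimpleGraph (Fin n)) {x y : Fin n} (hG : G.Adj x y) :
    (addEdge k G x y H).edist x y ≤ k := by
  rw [addEdge]
  split_ifs with h
  · have : (H ⊔ edge x y).edist x y = 1 := edist_eq_one_iff_adj.2 (by simp [edge_adj, hG.ne])
    rw [this]
    exact_mod_cast Nat.one_le_iff_ne_zero.2 hk
  · by_contra h'
    exact h ⟨hG, h'⟩

/-- A pair that has been treated stays within distance `k`, because the graph only grows; so one
pass over all pairs is enough. -/
theorem greedy_spec {n k : ℕ} (hk : 4 * n < 7 * k) {G T : SimpleGraph (Fin n)}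
    (hT : T.Connected) :
    FewLongEdges k G T (greedy k G T) ∧ ∀ x y, G.Adj x y → (greedy k G T).edist x y ≤ k := by
  have key := iterUpTo_induction (n := n) (a := T)
    (f := fun x => iterUpTo (fun y => addEdge k G x y) n)
    (fun i H => FewLongEdges k G T H ∧
      ∀ x y : Fin n, (x : ℕ) < i → G.Adj x y → H.edist x y ≤ k)
    ⟨Or.inl rfl, fun x y h => absurd h (Nat.not_lt_zero _)⟩ ?_
  · exact ⟨key.1, fun x y => key.2 x y x.isLt⟩
  intro x H ⟨hH, hd⟩
  have key := iterUpTo_induction (n := n) (a := H) (f := fun y => addEdge k G x y)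
    (fun j H => FewLongEdges k G T H ∧
      (∀ x' y' : Fin n, (x' : ℕ) < x → G.Adj x' y' → H.edist x' y' ≤ k) ∧
      ∀ y' : Fin n, (y' : ℕ) < j → G.Adj x y' → H.edist x y' ≤ k)
    ⟨hH, hd, fun y h => absurd h (Nat.not_lt_zero _)⟩ ?_
  · refine ⟨key.1, fun x' y' hx' hG => ?_⟩
    rcases Nat.lt_succ_iff_lt_or_eq.1 hx' with h | h
    · exact key.2.1 x' y' h hG
    · obtain rfl := Fin.ext h
      exact key.2.2 y' y'.isLt hG
  intro y H ⟨hH, hd, hd'⟩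
  have hle := le_addEdge (k := k) G H x y
  refine ⟨fewLongEdges_addEdge hk hT hH x y,
    fun x' y' h hG => (edist_anti hle).trans (hd x' y' h hG), fun y' hy' hG => ?_⟩
  rcases Nat.lt_succ_iff_lt_or_eq.1 hy' with h | h
  · exact (edist_anti hle).trans (hd' y' h hG)
  · obtain rfl := Fin.ext h
    exact edist_addEdge_le (by omega) H hG

/-- Edges between vertices at distance more than `k` do not close short cycles. -/
theorem FewLongEdges.exists_finset {n k : ℕ} {G T R : SimpleGraph (Fin n)}
    (hR : FewLongEdges k G T R) :
    ∃ F : Finset (Sym2 (Fin n)), F.card ≤ 2 ∧ R = T ⊔ fromEdgeSet (F : Set (Sym2 (Fin n))) ∧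
      (∀ x y, s(x, y) ∈ F → G.Adj x y ∧ (k : ℕ∞) < T.edist x y) ∧
      ∀ f ∈ F, ∀ (x : Fin n) (c : R.Walk x x), c.IsCycle → f ∈ c.edges → k + 1 < c.length := by
  have hswap : ∀ {D : SimpleGraph (Fin n)} {a b x y : Fin n}, s(x, y) = s(a, b) → G.Adj a b →
      (k : ℕ∞) < D.edist a b → G.Adj x y ∧ (k : ℕ∞) < D.edist x y := by
    intro D a b x y h hG hd
    rcases Sym2.eq_iff.1 h with ⟨rfl, rfl⟩ | ⟨rfl, rfl⟩
    · exact ⟨hG, hd⟩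
    · exact ⟨hG.symm, by rwa [edist_comm]⟩
  rcases hR with rfl | ⟨a, b, hG, hab, rfl⟩ | ⟨x₁, y₁, x₂, y₂, hG₁, hG₂, h₁, h₂, rfl⟩
  · exact ⟨∅, by simp, by simp, by simp, by simp⟩
  · refine ⟨{s(a, b)}, by simp, by simp [edge], fun x y h => ?_, fun f hf z d hd hfd => ?_⟩
    · exact hswap (Finset.mem_singleton.1 h) hG hab
    · rw [Finset.mem_singleton.1 hf] at hfd
      exact lt_length_of_mem_edges_sup_edge hab hd hfd
  · refine ⟨{s(x₁, y₁), s(x₂, y₂)}, Finset.card_le_two, ?_, fun x y h => ?_,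
      fun f hf z d hd hfd => ?_⟩
    · rw [sup_assoc, edge, edge, ← fromEdgeSet_union, Finset.coe_pair, Set.singleton_union]
    · rw [Finset.mem_insert, Finset.mem_singleton] at h
      rcases h with h | h
      · exact hswap h hG₁ h₁
      · exact hswap h hG₂ (h₂.trans_le (edist_anti le_sup_left))
    -- A cycle through the second edge is long by the choice of that edge. A cycle avoiding it lives
    -- in `T ⊔ edge x₁ y₁`, where the choice of the first edge applies.
    · by_cases h2 : s(x₂, y₂) ∈ d.edges
      · exact lt_length_of_mem_edges_sup_edge h₂ hd h2
      · have hmem : ∀ f ∈ d.edges, f ∈ (T ⊔ edge x₁ y₁).edgeSet := by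
          intro f hf
          have := d.edges_subset_edgeSet hf
          rw [edgeSet_sup] at this
          rcases this with h | h
          · exact h
          · rw [edge, edgeSet_fromEdgeSet] at h
            exact absurd (h.1 ▸ hf) h2
        have hf1 : f = s(x₁, y₁) := by
          rcases Finset.mem_insert.1 hf with h | h
          · exact h
          · exact absurd (Finset.mem_singleton.1 h ▸ hfd) h2
        rw [hf1] at hfd
        simpa using lt_length_of_mem_edges_sup_edge h₁ (hd.transfer hmem) (by simpa using hfd)

/-- Removing an edge `uv` of a shortest cycle and adding few long edges is a girth step. -/
theorem girthStep_of_fewLongEdges {n k : ℕ} (hk : k ≠ 0) {G H R : SimpleGraph (Fin n)}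
    (hHG : H ≤ G) {u v a : Fin n} {c : H.Walk a a} (hc : c.IsCycle)
    (hlen : (c.length : ℕ∞) = H.egirth) (hl : c.length ≤ k + 1) (he : s(u, v) ∈ c.edges)
    (hR : FewLongEdges k G (H.deleteEdges {s(u, v)}) R)
    (hd : ∀ x y, G.Adj x y → R.edist x y ≤ k) :
    GirthStep k G H R ∧ ShortCyclesIn k R (H.edgeSet \ {s(u, v)}) := by
  obtain ⟨F, hF2, hRF, hFT, hFl⟩ := hR.exists_finset
  have hTuv : (H.deleteEdges {s(u, v)}).edist u v ≤ k :=
    edist_deleteEdges_lt_of_mem_edges hc he hl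
  -- An edge of `H` either survives in `T`, with its ends at distance 1, or is `uv`, whose ends are
  -- joined by the rest of the cycle. So no inserted edge was in `H`.
  have hnew : ∀ x y, (k : ℕ∞) < (H.deleteEdges {s(u, v)}).edist x y → ¬ H.Adj x y := by
    intro x y hxy hH
    by_cases hT : (H.deleteEdges {s(u, v)}).Adj x y
    · rw [edist_eq_one_iff_adj.2 hT] at hxy
      have : k < 1 := by exact_mod_cast hxy
      omega
    · have : s(x, y) = s(u, v) := by
        by_contra hne
        exact hT (by rw [deleteEdges_adj]; exact ⟨hH, hne⟩)
      rcases Sym2.eq_iff.1 this with ⟨rfl, rfl⟩ | ⟨rfl, rfl⟩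
      · exact absurd hxy (not_lt.2 hTuv)
      · rw [edist_comm] at hxy
        exact absurd hxy (not_lt.2 hTuv)
  have hFG : (F : Set (Sym2 (Fin n))) ⊆ G.edgeSet \ H.edgeSet := by
    intro f hf
    induction f with | _ x y
    exact ⟨(hFT x y hf).1, hnew x y (hFT x y hf).2⟩
  have hRG : R ≤ G := by
    rw [hRF]
    refine sup_le ((deleteEdges_le _).trans hHG) ?_
    intro x y hxy
    exact (hFG ((fromEdgeSet_adj _).1 hxy).1).1
  exact ⟨⟨s(u, v), F, ⟨a, c, hc, hlen, hl, he⟩, hF2, hFG, hRF, isSpanner_of_adj hk hRG hd, hFl⟩,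
    shortCyclesIn_of_sup_fromEdgeSet (shortCyclesIn_edgeSet k H) hRF hFl⟩

/-! ### Clearing the cycle lengths in increasing order -/

/-- The invariant of the algorithm: all short cycles have more than `L` edges, and those with
`L + 1` edges avoid the pairs in `P`. -/
structure BreakInvariant {n : ℕ} (k : ℕ) (G H₀ : SimpleGraph (Fin n)) (L : ℕ)
    (P : Fin n → Fin n → Prop) (H : SimpleGraph (Fin n)) : Prop where
  steps : Relation.ReflTransGen (GirthStep k G) H₀ H
  spanner : IsSpanner k G H
  lt_length : ∀ (x : Fin n) (c : H.Walk x x), c.IsCycle → c.length ≤ k + 1 → L < c.length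
  notMem : ∀ (x : Fin n) (c : H.Walk x x), c.IsCycle → c.length ≤ k + 1 → c.length = L + 1 →
    ∀ a b, P a b → s(a, b) ∉ c.edges

theorem BreakInvariant.breakCycle {n k : ℕ} (hk : 4 * n < 7 * k) {G H₀ H : SimpleGraph (Fin n)}
    (hG : G.Connected) {L : Fin n} {P : Fin n → Fin n → Prop}
    (h : BreakInvariant k G H₀ L P H) (u v : Fin n) :
    BreakInvariant k G H₀ L (fun a b => P a b ∨ a = u ∧ b = v) (breakCycle k G L u v H) := by
  rw [_root_.breakCycle]
  split_ifs with hcond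
  · obtain ⟨hadj, hLk, hd⟩ := hcond
    obtain ⟨a, c, hc, hcl, hce⟩ := exists_isCycle_of_edist_deleteEdges_le hadj hd
    -- The distance test gives at most `L + 1`, the invariant at least `L + 1`; hence the cycle
    -- found is a smallest one.
    have hcL : c.length = L + 1 := by
      have := h.lt_length a c hc (by omega)
      omega
    have hgirth : (c.length : ℕ∞) = H.egirth := by
      refine le_antisymm (le_egirth.2 fun b w hw => ?_) (egirth_le_length hc)
      by_contra! hlt
      have hlt : w.length < c.length := by exact_mod_cast hlt
      have := h.lt_length b w hw (by omega)
      omega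
    have hT := (h.spanner.connected hG).deleteEdges_of_mem_edges hc hce
    obtain ⟨hfew, hshort⟩ := greedy_spec hk (G := G) hT
    obtain ⟨hstep, hsc⟩ := girthStep_of_fewLongEdges (by omega) h.spanner.1 hc hgirth (by omega) hce
      hfew hshort
    generalize greedy k G (H.deleteEdges {s(u, v)}) = R at *
    -- Short cycles of the repaired graph are old cycles avoiding `uv`, so what is known about the
    -- short cycles of `H` carries over.
    have htr : ∀ (x : Fin n) (c : R.Walk x x), c.IsCycle → c.length ≤ k + 1 →
        ∃ d : H.Walk x x, d.IsCycle ∧ d.length = c.length ∧ d.edges = c.edges := fun x c hc hl =>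
      ⟨c.transfer H fun f hf => (hsc x c hc hl f hf).1, hc.transfer _, by simp, by simp⟩
    refine ⟨h.steps.tail hstep, ?_, fun x c hc hl => ?_, fun x c hc hl hl' a b hab => ?_⟩
    · obtain ⟨-, -, -, -, -, -, hs, -⟩ := hstep
      exact hs
    · obtain ⟨d, hd, hdl, -⟩ := htr x c hc hl
      exact hdl ▸ h.lt_length x d hd (hdl ▸ hl)
    · rcases hab with hab | ⟨rfl, rfl⟩
      · obtain ⟨d, hd, hdl, hde⟩ := htr x c hc hl
        exact hde ▸ h.notMem x d hd (hdl ▸ hl) (hdl ▸ hl') a b hab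
      · exact fun hmem => (hsc x c hc hl _ hmem).2 rfl
  · refine ⟨h.steps, h.spanner, h.lt_length, fun x c hc hl hl' a b hab => ?_⟩
    rcases hab with hab | ⟨rfl, rfl⟩
    · exact h.notMem x c hc hl hl' a b hab
    · intro hmem
      exact hcond ⟨c.adj_of_mem_edges hmem, by omega,
        edist_deleteEdges_lt_of_mem_edges hc hmem hl'.le⟩

theorem breakCycles_spec {n k : ℕ} (hk : 4 * n < 7 * k) {G H : SimpleGraph (Fin n)}
    (hG : G.Connected) (hH : IsSpanner k G H) :
    Relation.ReflTransGen (GirthStep k G) H (breakCycles k G H) ∧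
      IsSpanner k G (breakCycles k G H) ∧
      ((k + 2 : ℕ) : ℕ∞) ≤ (breakCycles k G H).egirth := by
  unfold breakCycles
  have key := iterUpTo_induction (n := n) (a := H)
    (f := fun L => iterUpTo (fun u => iterUpTo (fun v => breakCycle k G L u v) n) n)
    (fun L R => BreakInvariant k G H L (fun _ _ => False) R)
    ⟨.refl, hH, fun x c hc _ => by have := hc.three_le_length; omega,
      fun _ _ _ _ _ _ _ h => h.elim⟩ ?_
  -- After the last round a short cycle would have more than `n` edges.
  · refine ⟨key.steps, key.spanner, le_egirth.2 fun a c hc => ?_⟩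
    by_contra! hlt
    have hlt : c.length < k + 2 := by exact_mod_cast hlt
    have h1 := key.lt_length a c hc (by omega)
    have h2 := hc.length_le_card
    rw [Fintype.card_fin] at h2
    omega
  intro L R hR
  have key := iterUpTo_induction (n := n) (a := R)
    (f := fun u => iterUpTo (fun v => breakCycle k G L u v) n)
    (fun i R => BreakInvariant k G H L (fun a _ => (a : ℕ) < i) R)
    ⟨hR.steps, hR.spanner, hR.lt_length, fun _ _ _ _ _ _ _ h => absurd h (Nat.not_lt_zero _)⟩ ?_
  · refine ⟨key.steps, key.spanner, fun x c hc hl => ?_, fun _ _ _ _ _ _ _ h => h.elim⟩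
    have h1 := key.lt_length x c hc hl
    -- All pairs have been tested, so a cycle of length `L + 1` would have no edge left to use.
    have h2 : c.length ≠ L + 1 := fun h2 => by
      have hne : c.edges ≠ [] := by
        rw [Ne, ← List.length_eq_zero_iff, Walk.length_edges]; omega
      obtain ⟨e, he⟩ := List.exists_mem_of_ne_nil _ hne
      induction e with | _ a b
      exact key.notMem x c hc hl h2 a b a.isLt he
    omega
  intro u R hR
  have key := iterUpTo_induction (n := n) (a := R)
    (f := fun v => breakCycle k G L u v)
    (fun j R => BreakInvariant k G H L
      (fun a b => (a : ℕ) < u ∨ a = u ∧ (b : ℕ) < j) R)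
    ⟨hR.steps, hR.spanner, hR.lt_length, fun x c hc hl hl' a b h =>
      hR.notMem x c hc hl hl' a b (h.resolve_right fun h => Nat.not_lt_zero _ h.2)⟩ ?_
  · refine ⟨key.steps, key.spanner, key.lt_length, fun x c hc hl hl' a b h =>
      key.notMem x c hc hl hl' a b ?_⟩
    rcases Nat.lt_succ_iff_lt_or_eq.1 h with h | h
    · exact Or.inl h
    · exact Or.inr ⟨Fin.ext h, b.isLt⟩
  intro v R hR
  have h := hR.breakCycle hk hG u v
  refine ⟨h.steps, h.spanner, h.lt_length, fun x c hc hl hl' a b hab =>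
    h.notMem x c hc hl hl' a b ?_⟩
  rcases hab with hab | ⟨hau, hb⟩
  · exact Or.inl (Or.inl hab)
  · rcases Nat.lt_succ_iff_lt_or_eq.1 hb with hb | hb
    · exact Or.inl (Or.inr ⟨hau, hb⟩)
    · exact Or.inr ⟨hau, Fin.ext hb⟩

/-! ### Verified programs -/

namespace RAM

/-- Started in memory `s`, the program `p` halts after at most `T` steps in a memory satisfying
`Q`. -/
def Runs (p : Prog) (s : Memory) (T : ℕ) (Q : Memory → Prop) : Prop :=
  ∃ (t : ℕ) (s' : Memory), Exec p s t s' ∧ t ≤ T ∧ Q s'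

theorem Runs.mono {p : Prog} {s : Memory} {T T' : ℕ} {Q Q' : Memory → Prop} (h : Runs p s T Q)
    (hT : T ≤ T') (hQ : ∀ s', Q s' → Q' s') : Runs p s T' Q' := by
  obtain ⟨t, s', he, ht, hq⟩ := h
  exact ⟨t, s', he, ht.trans hT, hQ s' hq⟩

theorem Runs.skip {s : Memory} {T : ℕ} {Q : Memory → Prop} (hQ : Q s) (hT : 1 ≤ T) :
    Runs Prog.skip s T Q := ⟨1, s, Exec.skip s, hT, hQ⟩

theorem Runs.assign {x : ℕ} {e : Expr} {s : Memory} {Q : Memory → Prop}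
    (hQ : Q (s.setReg x (e.val s))) : Runs (Prog.assign x e) s (e.cost + 1) Q :=
  ⟨_, _, Exec.assign x e s, le_rfl, hQ⟩

theorem Runs.store {A : ℕ} {i j e : Expr} {s : Memory} {Q : Memory → Prop}
    (hQ : Q (s.setMat A (i.val s) (j.val s) (e.val s))) :
    Runs (Prog.store A i j e) s (i.cost + j.cost + e.cost + 1) Q :=
  ⟨_, _, Exec.store A i j e s, le_rfl, hQ⟩

theorem Runs.seq {p q : Prog} {s : Memory} {T T' : ℕ} {Q : Memory → Prop}
    (h : Runs p s T fun s' => Runs q s' T' Q) : Runs (Prog.seq p q) s (T + T') Q := by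
  obtain ⟨t, s', he, ht, t', s'', he', ht', hq⟩ := h
  exact ⟨t + t', s'', he.seq he', add_le_add ht ht', hq⟩

theorem Runs.ite {e : Expr} {p q : Prog} {s : Memory} {T : ℕ} {Q : Memory → Prop}
    (hp : e.val s ≠ 0 → Runs p s T Q) (hq : e.val s = 0 → Runs q s T Q) :
    Runs (Prog.ite e p q) s (e.cost + 1 + T) Q := by
  by_cases h : e.val s = 0
  · obtain ⟨t, s', he, ht, hQ⟩ := hq h
    exact ⟨_, s', Exec.ite_false h he, by omega, hQ⟩
  · obtain ⟨t, s', he, ht, hQ⟩ := hp h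
    exact ⟨_, s', Exec.ite_true h he, by omega, hQ⟩

/-- Repeat `p` with register `i` running through `0, …, n - 1`, where `n` is in register `0`. -/
def forLoop (i : ℕ) (p : Prog) : Prog :=
  .seq (.assign i (.lit 0))
    (.loop (.sub (.var 0) (.var i)) (.seq p (.assign i (.add (.var i) (.lit 1)))))

/-- Per round, the test and the increment cost 4 steps each; the initialization and the final test
cost 2 and 4. The body has to leave the counter at `j`, since the increment reads it. -/
theorem Runs.forLoop {i n T : ℕ} {p : Prog} (Inv : ℕ → Memory → Prop) {s : Memory}
    {Q : Memory → Prop}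
    (hInv : ∀ j s', Inv j s' → s'.reg 0 = n ∧ s'.reg i = j) (h0 : Inv 0 (s.setReg i 0))
    (hstep : ∀ j < n, ∀ s', Inv j s' →
      Runs p s' T fun s'' => s''.reg i = j ∧ Inv (j + 1) (s''.setReg i (j + 1)))
    (hQ : ∀ s', Inv n s' → Q s') :
    Runs (RAM.forLoop i p) s (n * (T + 8) + 6) Q := by
  have key : ∀ m j, j + m = n → ∀ s', Inv j s' →
      Runs (.loop (.sub (.var 0) (.var i)) (.seq p (.assign i (.add (.var i) (.lit 1)))))
        s' (m * (T + 8) + 4) Q := by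
    intro m
    induction m with
    | zero =>
      intro j hj s' hs'
      obtain ⟨h1, h2⟩ := hInv j s' hs'
      refine ⟨_, s', Exec.loop_false ?_, by simp [Expr.cost], hQ s' ?_⟩
      · simp only [Expr.val]; omega
      · simpa [← hj] using hs'
    | succ m ih =>
      intro j hj s' hs'
      obtain ⟨h1, h2⟩ := hInv j s' hs'
      obtain ⟨t, s₁, he, ht, h3, h4⟩ := hstep j (by omega) s' hs'
      rw [← h3] at h4
      obtain ⟨t', s₂, he', ht', h5⟩ := ih (j + 1) (by omega) _ (h3 ▸ h4)
      refine ⟨_, s₂, Exec.loop_true (t' := t') ?_ (he.seq (Exec.assign _ _ _)) ?_, ?_, h5⟩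
      · simp only [Expr.val]; omega
      · simpa only [Expr.val, h3] using he'
      · simp only [Expr.cost]
        rw [Nat.succ_mul]
        omega
  obtain ⟨t, s', he, ht, hq⟩ := key n 0 (by omega) _ h0
  exact ⟨_, s', (Exec.assign i (.lit 0) s).seq he, by simp only [Expr.cost]; omega, hq⟩

@[simp] theorem Memory.setReg_reg (s : Memory) (x v y : ℕ) :
    (s.setReg x v).reg y = if y = x then v else s.reg y := rfl

@[simp] theorem Memory.setReg_mat (s : Memory) (x v : ℕ) : (s.setReg x v).mat = s.mat := rfl

@[simp] theorem Memory.setMat_reg (s : Memory) (A i j v : ℕ) :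
    (s.setMat A i j v).reg = s.reg := rfl

theorem Memory.setMat_mat (s : Memory) (A i j v B a b : ℕ) :
    (s.setMat A i j v).mat B a b = if B = A ∧ a = i ∧ b = j then v else s.mat B a b := rfl

theorem Memory.setMat_mat_self (s : Memory) (A i j v a b : ℕ) :
    (s.setMat A i j v).mat A a b = if a = i ∧ b = j then v else s.mat A a b := by
  simp [Memory.setMat_mat]

theorem Memory.setMat_mat_of_ne (s : Memory) {A B : ℕ} (h : B ≠ A) (i j v : ℕ) :
    (s.setMat A i j v).mat B = s.mat B := by
  ext a b
  simp [Memory.setMat_mat, h]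

/-! ### Testing distances -/

/-- `reach n M x t b`: in the graph on `{0, …, n - 1}` with adjacency matrix `M` there is a walk
of length at most `t` from `x` to `b`. -/
def reach (n : ℕ) (M : ℕ → ℕ → ℕ) (x : ℕ) : ℕ → ℕ → Prop
  | 0, b => b = x
  | t + 1, b => reach n M x t b ∨ ∃ a < n, M a b ≠ 0 ∧ reach n M x t a

theorem adjacency_ne_zero {n : ℕ} {H : SimpleGraph (Fin n)} {u v : Fin n} :
    adjacency H u v ≠ 0 ↔ H.Adj u v := by
  simp only [adjacency, ne_eq, ite_eq_right_iff, one_ne_zero, imp_false, not_not]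
  constructor
  · rintro ⟨a, b, ha, hb, h⟩
    rwa [← Fin.ext ha, ← Fin.ext hb]
  · exact fun h => ⟨u, v, rfl, rfl, h⟩

theorem reach_adjacency_iff {n : ℕ} {H : SimpleGraph (Fin n)} {x : Fin n} {t : ℕ} {b : Fin n} :
    reach n (adjacency H) x t b ↔ H.edist x b ≤ t := by
  induction t generalizing b with
  | zero =>
    simp only [reach, Nat.cast_zero, nonpos_iff_eq_zero, edist_eq_zero_iff]
    exact ⟨fun h => (Fin.ext h).symm, fun h => h ▸ rfl⟩
  | succ t ih =>
    rw [reach, ih]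
    constructor
    · rintro (h | ⟨a, ha, hab, h⟩)
      · exact h.trans (by exact_mod_cast Nat.le_succ t)
      · have h' : H.edist x ⟨a, ha⟩ ≤ t := ih.1 h
        have hadj : H.Adj ⟨a, ha⟩ b := adjacency_ne_zero.1 hab
        refine SimpleGraph.edist_triangle.trans
          ((add_le_add h' (edist_eq_one_iff_adj.2 hadj).le).trans ?_)
        push_cast
        exact le_rfl
    · intro h
      -- The walk is reversed so that its first edge is the last step into `b`, matching the
      -- recursion of `reach`.
      rw [edist_comm] at h
      obtain ⟨p, hp⟩ := exists_walk_of_edist_ne_top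
        (ne_top_of_le_ne_top (ENat.natCast_ne_top _) h)
      rw [← hp] at h
      have hl : p.length ≤ t + 1 := by exact_mod_cast h
      cases p with
      | nil => left; simp
      | @cons _ a _ hadj q =>
        refine Or.inr ⟨a, a.isLt, adjacency_ne_zero.2 hadj.symm, ih.2 ?_⟩
        rw [edist_comm]
        refine (edist_le q).trans ?_
        rw [Walk.length_cons] at hl
        exact_mod_cast (by omega)

/-- A path has fewer than `n` edges, so `n` rounds decide any bound `m`. This keeps the running time
independent of `k`. -/
theorem reach_min_iff {n : ℕ} {H : SimpleGraph (Fin n)} {x b : Fin n} {m : ℕ} :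
    reach n (adjacency H) x (min m n) b ↔ H.edist x b ≤ m := by
  classical
  rw [reach_adjacency_iff]
  refine ⟨fun h => h.trans (by exact_mod_cast min_le_left m n), fun h => ?_⟩
  obtain ⟨p, hp⟩ := exists_walk_of_edist_ne_top (ne_top_of_le_ne_top (ENat.natCast_ne_top _) h)
  have h1 := edist_le p.bypass
  have h2 := p.bypass_isPath.length_lt
  rw [Fintype.card_fin] at h2
  rcases le_total m n with hmn | hmn
  · rwa [min_eq_left hmn]
  · rw [min_eq_right hmn]
    exact h1.trans (by exact_mod_cast h2.le)

/-- Row `t` of matrix `3` becomes nonzero exactly at the vertices at distance at most `t` from the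
vertex in register `5`; register `8` becomes nonzero if and only if the distance to the vertex in
register `6` is at most the bound in register `7`. -/
def distTest : Prog :=
  .seq (forLoop 11 (.store 3 (.lit 0) (.var 11) (.lit 0)))
  (.seq (.store 3 (.lit 0) (.var 5) (.lit 1))
  (.seq (forLoop 9 (forLoop 11
      (.seq (.store 3 (.add (.var 9) (.lit 1)) (.var 11) (.cell 3 (.var 9) (.var 11)))
        (forLoop 10 (.ite (.cell 1 (.var 10) (.var 11))
          (.store 3 (.add (.var 9) (.lit 1)) (.var 11)
            (.add (.cell 3 (.add (.var 9) (.lit 1)) (.var 11)) (.cell 3 (.var 9) (.var 10))))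
          .skip)))))
    (.ite (.sub (.var 7) (.var 0)) (.assign 8 (.cell 3 (.var 0) (.var 6)))
      (.assign 8 (.cell 3 (.var 7) (.var 6))))))

/-- `s'` agrees with `s` on registers below `r` and on all matrices but `A`. -/
def Frame (r A : ℕ) (s s' : Memory) : Prop :=
  (∀ x < r, s'.reg x = s.reg x) ∧ ∀ B, B ≠ A → s'.mat B = s.mat B

theorem Frame.setReg {r A x v : ℕ} {s s' : Memory} (h : Frame r A s s') (hx : r ≤ x) :
    Frame r A s (s'.setReg x v) := by
  refine ⟨fun y hy => ?_, h.2⟩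
  rw [Memory.setReg_reg, if_neg (by omega)]
  exact h.1 y hy

theorem Frame.setMat {r A i j v : ℕ} {s s' : Memory} (h : Frame r A s s') :
    Frame r A s (s'.setMat A i j v) :=
  ⟨h.1, fun B hB => by rw [Memory.setMat_mat_of_ne s' hB, h.2 B hB]⟩

theorem Frame.refl (r A : ℕ) (s : Memory) : Frame r A s s := ⟨fun _ _ => rfl, fun _ _ => rfl⟩

/-- A bound for the running time of `distTest`. -/
def distTime (n : ℕ) : ℕ :=
  n * (4 + 8) + 6 + (4 + (n * (n * (8 + (n * (18 + 8) + 6) + 8) + 6 + 8) + 6 + 8))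

theorem runs_distTest {n : ℕ} {s : Memory} (hn : s.reg 0 = n) (hy : s.reg 6 < n) :
    Runs distTest s (distTime n) fun s' => Frame 8 3 s s' ∧
      (s'.reg 8 ≠ 0 ↔ reach n (s.mat 1) (s.reg 5) (min (s.reg 7) n) (s.reg 6)) := by
  set R := reach n (s.mat 1) (s.reg 5) with hR
  -- Matrix `3` may hold data of an earlier call. Row `0` is therefore cleared, and every entry of a
  -- later row is overwritten before anything is added to it.
  refine Runs.seq (Runs.forLoop (n := n) (T := 4)
    (fun j s' => Frame 8 3 s s' ∧ s'.reg 11 = j ∧ ∀ b < j, s'.mat 3 0 b = 0) ?_ ?_ ?_ ?_)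
  · exact fun j s' h => ⟨(h.1.1 0 (by omega)).trans hn, h.2.1⟩
  · exact ⟨(Frame.refl 8 3 s).setReg (by omega), by simp, by simp⟩
  · rintro j hj s₁ ⟨hF, h11, h3⟩
    refine (Runs.store ?_).mono (by simp [Expr.cost]) fun _ h => h
    refine ⟨by simpa using h11, hF.setMat.setReg (by omega), by simp, fun b hb => ?_⟩
    simp only [Memory.setReg_mat, Memory.setMat_mat_self, Expr.val, h11, true_and]
    split_ifs with h
    · rfl
    · exact h3 b (by omega)
  rintro s₁ ⟨hF₁, -, h3₁⟩
  have h5₁ := hF₁.1 5 (by omega)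
  refine Runs.seq ((Runs.store ?_).mono (T' := 4) (by simp [Expr.cost]) fun _ h => h)
  refine Runs.seq (Runs.forLoop (n := n)
    (fun t s' => Frame 8 3 s s' ∧ s'.reg 9 = t ∧
      ∀ t' ≤ t, ∀ b < n, (s'.mat 3 t' b ≠ 0 ↔ R t' b)) ?_ ?_ ?_ ?_)
  · exact fun j s' h => ⟨(h.1.1 0 (by omega)).trans hn, h.2.1⟩
  · refine ⟨hF₁.setMat.setReg (by omega), by simp, fun t' ht b hb => ?_⟩
    obtain rfl : t' = 0 := by omega
    simp only [Memory.setReg_mat, Memory.setMat_mat_self, Expr.val, h5₁, true_and, hR, reach]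
    split_ifs with h
    · simp [h]
    · simp [h, h3₁ b hb]
  · rintro t ht s₂ ⟨hF₂, h9₂, hrow₂⟩
    refine Runs.forLoop (n := n) (T := 8 + (n * (18 + 8) + 6))
      (fun b s' => Frame 8 3 s s' ∧ s'.reg 9 = t ∧ s'.reg 11 = b ∧
        (∀ t' ≤ t, ∀ b < n, (s'.mat 3 t' b ≠ 0 ↔ R t' b)) ∧
        ∀ b' < b, (s'.mat 3 (t + 1) b' ≠ 0 ↔ R (t + 1) b')) ?_ ?_ ?_ ?_
    · exact fun j s' h => ⟨(h.1.1 0 (by omega)).trans hn, h.2.2.1⟩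
    · exact ⟨hF₂.setReg (by omega), by simpa using h9₂, by simp, by simpa using hrow₂, by simp⟩
    · rintro b hb s₃ ⟨hF₃, h9₃, h11₃, hrow₃, hcur₃⟩
      refine Runs.seq ((Runs.store ?_).mono (T' := 8) (by simp [Expr.cost]) fun _ h => h)
      refine Runs.forLoop (n := n) (T := 18)
        (fun a s' => Frame 8 3 s s' ∧ s'.reg 9 = t ∧ s'.reg 11 = b ∧ s'.reg 10 = a ∧
          (∀ t' ≤ t, ∀ b < n, (s'.mat 3 t' b ≠ 0 ↔ R t' b)) ∧
          (∀ b' < b, (s'.mat 3 (t + 1) b' ≠ 0 ↔ R (t + 1) b')) ∧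
          (s'.mat 3 (t + 1) b ≠ 0 ↔ R t b ∨ ∃ a' < a, s.mat 1 a' b ≠ 0 ∧ R t a')) ?_ ?_ ?_ ?_
      · exact fun j s' h => ⟨(h.1.1 0 (by omega)).trans hn, h.2.2.2.1⟩
      · refine ⟨hF₃.setMat.setReg (by omega), by simpa using h9₃, by simpa using h11₃, by simp,
          fun t' ht' b' hb' => ?_, fun b' hb' => ?_, ?_⟩
        · simp only [Memory.setReg_mat, Memory.setMat_mat_self, Expr.val, h9₃]
          rw [if_neg (by omega)]
          exact hrow₃ t' ht' b' hb'
        · simp only [Memory.setReg_mat, Memory.setMat_mat_self, Expr.val, h11₃]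
          rw [if_neg (by omega)]
          exact hcur₃ b' hb'
        · simp only [Memory.setReg_mat, Memory.setMat_mat_self, Expr.val, h9₃, h11₃]
          rw [if_pos (by simp)]
          simpa using hrow₃ t le_rfl b hb
      · rintro a ha s₄ ⟨hF₄, h9₄, h11₄, h10₄, hrow₄, hcur₄, hb₄⟩
        have hM : s₄.mat 1 = s.mat 1 := hF₄.2 1 (by omega)
        have hlt : ∀ P : ℕ → Prop, (∃ a' < a + 1, P a') ↔ (∃ a' < a, P a') ∨ P a := by
          intro P
          constructor
          · rintro ⟨a', h1, h2⟩
            rcases Nat.lt_succ_iff_lt_or_eq.1 h1 with h | rfl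
            · exact Or.inl ⟨a', h, h2⟩
            · exact Or.inr h2
          · rintro (⟨a', h1, h2⟩ | h)
            · exact ⟨a', by omega, h2⟩
            · exact ⟨a, by omega, h⟩
        refine (Runs.ite (T := 14) (fun he => (Runs.store ?_).mono (by simp [Expr.cost])
          fun _ h => h) (fun he => Runs.skip ?_ (by omega))).mono
          (by simp [Expr.cost]) fun _ h => h
        · simp only [Expr.val, h10₄, h11₄, hM] at he
          refine ⟨by simpa using h10₄, hF₄.setMat.setReg (by omega), by simpa using h9₄,
            by simpa using h11₄, by simp, fun t' ht' b' hb' => ?_, fun b' hb' => ?_, ?_⟩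
          · simp only [Memory.setReg_mat, Memory.setMat_mat_self, Expr.val, h9₄]
            rw [if_neg (by omega)]
            exact hrow₄ t' ht' b' hb'
          · simp only [Memory.setReg_mat, Memory.setMat_mat_self, Expr.val, h11₄]
            rw [if_neg (by omega)]
            exact hcur₄ b' hb'
          · simp only [Memory.setReg_mat, Memory.setMat_mat_self, Expr.val, h9₄, h11₄, h10₄]
            -- A sum of natural numbers is nonzero exactly when a summand is, so addition serves as
            -- disjunction.
            rw [if_pos (by simp), hlt, ← or_assoc, ← hb₄, ← hrow₄ t le_rfl a ha]
            simp only [he, true_and, ne_eq, not_false_eq_true]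
            omega
        · simp only [Expr.val, h10₄, h11₄, hM] at he
          refine ⟨h10₄, hF₄.setReg (by omega), by simpa using h9₄, by simpa using h11₄,
            by simp, hrow₄, hcur₄, ?_⟩
          rw [hlt]
          simpa [he] using hb₄
      · rintro s₄ ⟨hF₄, h9₄, h11₄, -, hrow₄, hcur₄, hb₄⟩
        refine ⟨h11₄, hF₄.setReg (by omega), by simpa using h9₄, by simp, hrow₄,
          fun b' hb' => ?_⟩
        rcases Nat.lt_succ_iff_lt_or_eq.1 hb' with h | rfl
        · exact hcur₄ b' h
        · exact hb₄
    · rintro s₃ ⟨hF₃, h9₃, -, hrow₃, hcur₃⟩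
      refine ⟨h9₃, hF₃.setReg (by omega), by simp, fun t' ht' b hb => ?_⟩
      rcases Nat.lt_succ_iff_lt_or_eq.1 (Nat.lt_succ_of_le ht') with h | rfl
      · exact hrow₃ t' (by omega) b hb
      · exact hcur₃ b hb
  · rintro s₂ ⟨hF₂, -, hrow₂⟩
    have h0 := (hF₂.1 0 (by omega)).trans hn
    have h6 := hF₂.1 6 (by omega)
    have h7 := hF₂.1 7 (by omega)
    refine (Runs.ite (T := 4) (fun he => Runs.assign ?_) (fun he => Runs.assign ?_)).mono
      (by simp [Expr.cost]) fun _ h => h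
    · simp only [Expr.val, h0, h7] at he
      refine ⟨hF₂.setReg le_rfl, ?_⟩
      simp only [Memory.setReg_reg, Expr.val, h0, h6, if_true]
      rw [min_eq_right (by omega)]
      exact hrow₂ n le_rfl _ hy
    · simp only [Expr.val, h0, h7] at he
      refine ⟨hF₂.setReg le_rfl, ?_⟩
      simp only [Memory.setReg_reg, Expr.val, h7, h6, if_true]
      rw [min_eq_left (by omega)]
      exact hrow₂ _ (by omega) _ hy

/-! ### The programs -/

/-- The memory represents `n`, `k`, `G` and the current graph `H`. -/
structure Represents {n : ℕ} (k : ℕ) (G H : SimpleGraph (Fin n)) (s : Memory) : Prop where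
  reg_zero : s.reg 0 = n
  reg_one : s.reg 1 = k
  mat_zero : s.mat 0 = adjacency G
  mat_one : s.mat 1 = adjacency H

theorem Represents.of_eq {n k : ℕ} {G H H' : SimpleGraph (Fin n)} {s s' : Memory}
    (h : Represents k G H s) (h0 : s'.reg 0 = s.reg 0) (h1 : s'.reg 1 = s.reg 1)
    (hm0 : s'.mat 0 = s.mat 0) (hm1 : s'.mat 1 = adjacency H') : Represents k G H' s' :=
  ⟨h0.trans h.reg_zero, h1.trans h.reg_one, hm0.trans h.mat_zero, hm1⟩

theorem Represents.frame {n k r : ℕ} (hr : 2 ≤ r) {G H : SimpleGraph (Fin n)} {s s' : Memory}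
    (h : Represents k G H s) (hF : Frame r 3 s s') : Represents k G H s' :=
  h.of_eq (hF.1 0 (by omega)) (hF.1 1 (by omega)) (hF.2 0 (by omega))
    ((hF.2 1 (by omega)).trans h.mat_one)

theorem Represents.setReg {n k x v : ℕ} (hx : 2 ≤ x) {G H : SimpleGraph (Fin n)} {s : Memory}
    (h : Represents k G H s) : Represents k G H (s.setReg x v) :=
  h.of_eq (by simp; omega) (by simp; omega) rfl h.mat_one

/-- Write `c` into both entries of matrix `1` given by the registers `x` and `y`. -/
def setPair (x y c : ℕ) : Prog :=
  .seq (.store 1 (.var x) (.var y) (.lit c)) (.store 1 (.var y) (.var x) (.lit c))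

/-- The nested conditionals in `hH'` mirror the order of the two writes, the later one outermost.
With `c = 1` this inserts an edge, with `c = 0` it deletes one. -/
theorem runs_setPair {n k x y c : ℕ} {G H H' : SimpleGraph (Fin n)} {s : Memory} {u v : Fin n}
    (h : Represents k G H s) (hx : s.reg x = u) (hy : s.reg y = v)
    (hH' : ∀ i j : ℕ, adjacency H' i j =
      if i = v ∧ j = u then c else if i = u ∧ j = v then c else adjacency H i j) :
    Runs (setPair x y c) s 8 fun s' => Represents k G H' s' ∧ s'.reg = s.reg := by
  refine Runs.seq (T := 4) (T' := 4) ((Runs.store ?_).mono (by simp [Expr.cost]) fun _ h => h)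
  refine (Runs.store ?_).mono (by simp [Expr.cost]) fun _ h => h
  refine ⟨h.of_eq rfl rfl ?_ ?_, rfl⟩
  · rw [Memory.setMat_mat_of_ne _ (by omega), Memory.setMat_mat_of_ne _ (by omega)]
  · ext i j
    simp only [Memory.setMat_mat_self, Memory.setMat_reg, Expr.val, hx, hy, h.mat_one, hH']

open Classical in
theorem adjacency_coe {n : ℕ} (H : SimpleGraph (Fin n)) (u v : Fin n) :
    adjacency H u v = if H.Adj u v then 1 else 0 := by
  by_cases h : H.Adj u v
  · rw [if_pos h, adjacency, if_pos ⟨u, v, rfl, rfl, h⟩]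
  · rw [if_neg h]
    exact not_not.1 fun h' => h (adjacency_ne_zero.1 h')

theorem adjacency_congr {n : ℕ} {H H' : SimpleGraph (Fin n)} {u v : Fin n}
    (h : H.Adj u v ↔ H'.Adj u v) : adjacency H u v = adjacency H' u v := by
  by_cases h' : H'.Adj u v
  · rw [adjacency_coe, adjacency_coe, if_pos h', if_pos (h.2 h')]
  · rw [adjacency_coe, adjacency_coe, if_neg h', if_neg (h.not.2 h')]

theorem adjacency_sup_edge {n : ℕ} (H : SimpleGraph (Fin n)) {u v : Fin n} (huv : u ≠ v)
    (i j : ℕ) : adjacency (H ⊔ edge u v) i j =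
      if i = v ∧ j = u then 1 else if i = u ∧ j = v then 1 else adjacency H i j := by
  by_cases hi : i < n
  · by_cases hj : j < n
    · lift i to Fin n using hi
      lift j to Fin n using hj
      simp only [Fin.val_inj]
      by_cases h1 : i = v ∧ j = u
      · obtain ⟨rfl, rfl⟩ := h1
        rw [adjacency_coe, if_pos (by simp [edge_adj, huv.symm]), if_pos ⟨rfl, rfl⟩]
      · by_cases h2 : i = u ∧ j = v
        · obtain ⟨rfl, rfl⟩ := h2
          rw [adjacency_coe, if_pos (by simp [edge_adj, huv]), if_neg h1, if_pos ⟨rfl, rfl⟩]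
        · rw [if_neg h1, if_neg h2]
          exact adjacency_congr (by simp [edge_adj, h1, h2])
    · have hju : j ≠ u := fun h => hj (h ▸ u.isLt)
      have hjv : j ≠ v := fun h => hj (h ▸ v.isLt)
      have hnot : ∀ w : Fin n, (w : ℕ) ≠ j := fun w h => hj (h ▸ w.isLt)
      simp [adjacency, hju, hjv, hnot]
  · have hju : i ≠ u := fun h => hi (h ▸ u.isLt)
    have hjv : i ≠ v := fun h => hi (h ▸ v.isLt)
    have hnot : ∀ w : Fin n, (w : ℕ) ≠ i := fun w h => hi (h ▸ w.isLt)
    simp [adjacency, hju, hjv, hnot]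

theorem adjacency_deleteEdges {n : ℕ} (H : SimpleGraph (Fin n)) (u v : Fin n)
    (i j : ℕ) : adjacency (H.deleteEdges {s(u, v)}) i j =
      if i = v ∧ j = u then 0 else if i = u ∧ j = v then 0 else adjacency H i j := by
  by_cases hi : i < n
  · by_cases hj : j < n
    · lift i to Fin n using hi
      lift j to Fin n using hj
      simp only [Fin.val_inj]
      by_cases h1 : i = v ∧ j = u
      · rw [adjacency_coe, if_neg (by simp [h1, Sym2.eq_swap]), if_pos h1]
      · by_cases h2 : i = u ∧ j = v
        · rw [adjacency_coe, if_neg (by simp [h2]), if_neg h1, if_pos h2]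
        · rw [if_neg h1, if_neg h2]
          exact adjacency_congr (by simp [h1, h2])
    · have hnot : ∀ w : Fin n, (w : ℕ) ≠ j := fun w h => hj (h ▸ w.isLt)
      simp [adjacency, hnot]
  · have hnot : ∀ w : Fin n, (w : ℕ) ≠ i := fun w h => hi (h ▸ w.isLt)
    simp [adjacency, hnot]

/-- Add the pair of vertices in registers `5` and `6` to the current graph if they are adjacent in
`G` and at distance more than `k`. -/
def addEdgeProg : Prog :=
  .ite (.cell 0 (.var 5) (.var 6))
    (.seq (.assign 7 (.var 1)) (.seq distTest (.ite (.var 8) .skip (setPair 5 6 1)))) .skip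

/-- A bound for the running time of `addEdgeProg`. -/
def addEdgeTime (n : ℕ) : ℕ := 4 + (2 + (distTime n + (2 + 8)))

theorem runs_addEdgeProg {n k : ℕ} {G H : SimpleGraph (Fin n)} {s : Memory}
    (h : Represents k G H s) {x y : Fin n} (hx : s.reg 5 = x) (hy : s.reg 6 = y) :
    Runs addEdgeProg s (addEdgeTime n) fun s' =>
      Represents k G (addEdge k G x y H) s' ∧ ∀ r < 7, s'.reg r = s.reg r := by
  refine Runs.ite (fun he => ?_) (fun he => ?_)
  swap
  · refine Runs.skip ⟨?_, fun _ _ => rfl⟩ (by omega)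
    simp only [Expr.val, hx, hy, h.mat_zero] at he
    rw [addEdge, if_neg fun hc => adjacency_ne_zero.2 hc.1 he]
    exact h
  simp only [Expr.val, hx, hy, h.mat_zero] at he
  have hG : G.Adj x y := adjacency_ne_zero.1 he
  refine Runs.seq (Runs.assign ?_)
  simp only [Expr.val, h.reg_one]
  have h1 : Represents k G H (s.setReg 7 k) := h.setReg (by omega)
  refine Runs.seq ((runs_distTest (n := n) h1.reg_zero (by simp [hy])).mono le_rfl
    ?_)
  rintro s₁ ⟨hF, h8⟩
  have h2 : Represents k G H s₁ := h1.frame (by omega) hF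
  have hreg : ∀ r < 7, s₁.reg r = s.reg r := fun r hr => by
    rw [hF.1 r (by omega), Memory.setReg_reg, if_neg (by omega)]
  rw [h1.mat_one] at h8
  simp only [Memory.setReg_reg, hx, hy] at h8
  norm_num at h8
  rw [← ne_eq, reach_min_iff] at h8
  refine Runs.ite (fun he => ?_) (fun he => ?_)
  · refine Runs.skip ⟨?_, hreg⟩ (by omega)
    rw [addEdge, if_neg fun hc => hc.2 (h8.1 he)]
    exact h2
  · rw [addEdge, if_pos ⟨hG, fun hc => h8.2 hc he⟩]
    refine (runs_setPair h2 ((hreg 5 (by omega)).trans hx) ((hreg 6 (by omega)).trans hy)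
      (adjacency_sup_edge H hG.ne)).mono le_rfl ?_
    rintro s₂ ⟨h3, h4⟩
    exact ⟨h3, fun r hr => by rw [h4, hreg r hr]⟩

/-- Loops over programs that transform the current graph. -/
theorem runs_forLoop_iterUpTo {n k i T : ℕ} (hi : 2 ≤ i) {p : Prog} {G H : SimpleGraph (Fin n)}
    {f : Fin n → SimpleGraph (Fin n) → SimpleGraph (Fin n)} {s : Memory}
    (h : Represents k G H s)
    (hp : ∀ (j : Fin n) (H' : SimpleGraph (Fin n)) (s' : Memory), Represents k G H' s' →
      (∀ r < i, s'.reg r = s.reg r) → s'.reg i = j →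
      Runs p s' T fun s'' => Represents k G (f j H') s'' ∧ ∀ r < i + 1, s''.reg r = s'.reg r) :
    Runs (forLoop i p) s (n * (T + 8) + 6) fun s' =>
      Represents k G (iterUpTo f n H) s' ∧ ∀ r < i, s'.reg r = s.reg r := by
  refine Runs.forLoop (fun j s' => Represents k G (iterUpTo f j H) s' ∧
    (∀ r < i, s'.reg r = s.reg r) ∧ s'.reg i = j) ?_ ?_ ?_ ?_
  · exact fun j s' hs' => ⟨hs'.1.reg_zero, hs'.2.2⟩
  · refine ⟨h.setReg hi, fun r hr => ?_, by simp⟩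
    rw [Memory.setReg_reg, if_neg (by omega)]
  · rintro j hj s' ⟨h1, h2, h3⟩
    refine (hp ⟨j, hj⟩ _ s' h1 h2 h3).mono le_rfl ?_
    rintro s'' ⟨h4, h5⟩
    refine ⟨(h5 i (by omega)).trans h3, ?_, fun r hr => ?_, by simp⟩
    · rw [iterUpTo_succ f ⟨j, hj⟩]
      exact h4.setReg hi
    · rw [Memory.setReg_reg, if_neg (by omega), h5 r (by omega), h2 r hr]
  · exact fun s' hs' => ⟨hs'.1, hs'.2.1⟩

/-- Process all edges of `G` greedily. -/
def greedyProg : Prog := forLoop 5 (forLoop 6 addEdgeProg)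

/-- A bound for the running time of `greedyProg`. -/
def greedyTime (n : ℕ) : ℕ := n * (n * (addEdgeTime n + 8) + 6 + 8) + 6

theorem runs_greedyProg {n k : ℕ} {G H : SimpleGraph (Fin n)} {s : Memory}
    (h : Represents k G H s) :
    Runs greedyProg s (greedyTime n) fun s' =>
      Represents k G (greedy k G H) s' ∧ ∀ r < 5, s'.reg r = s.reg r := by
  refine runs_forLoop_iterUpTo (by omega) h fun x H₁ s₁ h₁ _ hx => ?_
  refine runs_forLoop_iterUpTo (by omega) h₁ fun y H₂ s₂ h₂ hr hy => ?_
  exact runs_addEdgeProg h₂ ((hr 5 (by omega)).trans hx) hy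

/-- Remove the edge between the vertices in registers `3` and `4` if it lies on a cycle that is
short with respect to the bound in register `2`. -/
def breakCycleProg : Prog :=
  .ite (.cell 1 (.var 3) (.var 4))
    (.ite (.sub (.add (.var 1) (.lit 1)) (.var 2))
      (.seq (setPair 3 4 0) (.seq (.assign 5 (.var 3)) (.seq (.assign 6 (.var 4))
        (.seq (.assign 7 (.var 2)) (.seq distTest (.ite (.var 8) greedyProg (setPair 3 4 1)))))))
      .skip)
    .skip

/-- A bound for the running time of `breakCycleProg`. -/
def breakCycleTime (n : ℕ) : ℕ :=
  4 + (6 + (8 + (2 + (2 + (2 + (distTime n + (2 + (greedyTime n + 8))))))))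

/-- The program deletes `uv` before testing the distance; if the test fails, putting the edge back
restores `H`. -/
theorem sup_edge_deleteEdges {n : ℕ} {H : SimpleGraph (Fin n)} {u v : Fin n} (h : H.Adj u v) :
    H.deleteEdges {s(u, v)} ⊔ edge u v = H := by
  ext a b
  simp only [sup_adj, deleteEdges_adj, edge_adj, Set.mem_singleton_iff, Sym2.eq_iff]
  constructor
  · rintro (h' | ⟨⟨rfl, rfl⟩ | ⟨rfl, rfl⟩, -⟩)
    · exact h'.1
    · exact h
    · exact h.symm
  · intro h'
    have := h'.ne
    tauto

theorem runs_breakCycleProg {n k : ℕ} {G H : SimpleGraph (Fin n)} {s : Memory}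
    (h : Represents k G H s) {L u v : Fin n} (hL : s.reg 2 = L) (hu : s.reg 3 = u)
    (hv : s.reg 4 = v) :
    Runs breakCycleProg s (breakCycleTime n) fun s' =>
      Represents k G (breakCycle k G L u v H) s' ∧ ∀ r < 5, s'.reg r = s.reg r := by
  refine Runs.ite (fun he => ?_) (fun he => ?_)
  swap
  · refine Runs.skip ⟨?_, fun _ _ => rfl⟩ (by omega)
    simp only [Expr.val, hu, hv, h.mat_one] at he
    rw [breakCycle, if_neg fun hc => adjacency_ne_zero.2 hc.1 he]
    exact h
  simp only [Expr.val, hu, hv, h.mat_one] at he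
  have hH : H.Adj u v := adjacency_ne_zero.1 he
  refine Runs.ite (fun he => ?_) (fun he => ?_)
  swap
  · refine Runs.skip ⟨?_, fun _ _ => rfl⟩ (by omega)
    simp only [Expr.val, h.reg_one, hL] at he
    rw [breakCycle, if_neg fun hc => by have := hc.2.1; omega]
    exact h
  simp only [Expr.val, h.reg_one, hL] at he
  have hLk : (L : ℕ) ≤ k := by omega
  refine Runs.seq ((runs_setPair h hu hv (adjacency_deleteEdges H u v)).mono le_rfl ?_)
  rintro s₀ ⟨h₀, hreg₀⟩
  refine Runs.seq (Runs.assign (Runs.seq (Runs.assign (Runs.seq (Runs.assign ?_)))))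
  simp only [Expr.val, Memory.setReg_reg, hreg₀, hu, hv, hL]
  norm_num
  set T := H.deleteEdges {s(u, v)} with hT
  have h₁ : Represents k G T (((s₀.setReg 5 u).setReg 6 v).setReg 7 L) :=
    ((h₀.setReg (by omega)).setReg (by omega)).setReg (by omega)
  refine Runs.seq ((runs_distTest (n := n) h₁.reg_zero (by simp)).mono le_rfl ?_)
  rintro s₁ ⟨hF, h8⟩
  have h₂ : Represents k G T s₁ := h₁.frame (by omega) hF
  have hreg : ∀ r < 5, s₁.reg r = s.reg r := fun r hr => by
    rw [hF.1 r (by omega), Memory.setReg_reg, if_neg (by omega), Memory.setReg_reg,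
      if_neg (by omega), Memory.setReg_reg, if_neg (by omega), hreg₀]
  rw [h₁.mat_one] at h8
  simp only [Memory.setReg_reg] at h8
  norm_num at h8
  -- As `L < n`, the cap of the bound at `n` has no effect.
  rw [← ne_eq, reach_adjacency_iff] at h8
  refine Runs.ite (fun he => ?_) (fun he => ?_)
  · rw [breakCycle, if_pos ⟨hH, hLk, h8.1 he⟩]
    refine (runs_greedyProg h₂).mono (by omega) ?_
    rintro s₂ ⟨h₃, h₄⟩
    exact ⟨h₃, fun r hr => (h₄ r hr).trans (hreg r hr)⟩
  · rw [breakCycle, if_neg fun hc => h8.2 hc.2.2 he]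
    have hadj := adjacency_sup_edge T hH.ne
    rw [sup_edge_deleteEdges hH] at hadj
    refine (runs_setPair h₂ ((hreg 3 (by omega)).trans hu) ((hreg 4 (by omega)).trans hv)
      hadj).mono (by omega) ?_
    rintro s₂ ⟨h₃, h₄⟩
    exact ⟨h₃, fun r hr => by rw [h₄, hreg r hr]⟩

/-- Break all short cycles and copy the resulting graph into matrix `2`. -/
def spannerProg : Prog :=
  .seq (forLoop 2 (forLoop 3 (forLoop 4 breakCycleProg)))
    (forLoop 2 (forLoop 3 (.store 2 (.var 2) (.var 3) (.cell 1 (.var 2) (.var 3)))))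

/-- A bound for the running time of `spannerProg`. -/
def spannerTime (n : ℕ) : ℕ :=
  n * (n * (n * (breakCycleTime n + 8) + 6 + 8) + 6 + 8) + 6 + (n * (n * (6 + 8) + 6 + 8) + 6)

theorem runs_spannerProg (n k : ℕ) (G H : SimpleGraph (Fin n)) :
    Runs spannerProg (input n k G H) (spannerTime n) fun s =>
      Outputs s (breakCycles k G H) := by
  have h : Represents k G H (input n k G H) :=
    ⟨by simp [input], by simp [input], by ext; simp [input], by ext; simp [input]⟩
  refine Runs.seq ((runs_forLoop_iterUpTo (T := n * (n * (breakCycleTime n + 8) + 6 + 8) + 6)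
    (f := fun L => iterUpTo (fun u => iterUpTo (fun v => breakCycle k G L u v) n) n)
    (by omega) h fun L H₁ s₁ h₁ _ hL => ?_).mono le_rfl ?_)
  · refine runs_forLoop_iterUpTo (by omega) h₁ fun u H₂ s₂ h₂ hr₂ hu => ?_
    refine runs_forLoop_iterUpTo (by omega) h₂ fun v H₃ s₃ h₃ hr₃ hv => ?_
    exact runs_breakCycleProg h₃ (by rw [hr₃ 2 (by omega), hr₂ 2 (by omega), hL])
      (by rw [hr₃ 3 (by omega), hu]) hv
  rintro s ⟨hs, -⟩
  change Represents k G (breakCycles k G H) s at hs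
  generalize breakCycles k G H = R at hs
  refine Runs.forLoop (n := n) (fun i s' => Represents k G R s' ∧ s'.reg 2 = i ∧
    ∀ a < i, ∀ b < n, s'.mat 2 a b = adjacency R a b) ?_ ?_ ?_ ?_
  · exact fun j s' h => ⟨h.1.reg_zero, h.2.1⟩
  · exact ⟨hs.setReg le_rfl, by simp, by simp⟩
  · rintro i hi s₁ ⟨h₁, hi₁, hm₁⟩
    refine Runs.forLoop (n := n) (fun j s' => Represents k G R s' ∧ s'.reg 2 = i ∧
      s'.reg 3 = j ∧ (∀ a < i, ∀ b < n, s'.mat 2 a b = adjacency R a b) ∧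
      ∀ b < j, s'.mat 2 i b = adjacency R i b) ?_ ?_ ?_ ?_
    · exact fun j s' h => ⟨h.1.reg_zero, h.2.2.1⟩
    · exact ⟨h₁.setReg (by omega), by simpa using hi₁, by simp, hm₁, by simp⟩
    · rintro j hj s₂ ⟨h₂, hi₂, hj₂, hm₂, hc₂⟩
      refine (Runs.store ?_).mono (by simp [Expr.cost]) fun _ h => h
      simp only [Expr.val, hi₂, hj₂, h₂.mat_one]
      refine ⟨by simpa using hj₂, Represents.setReg (by omega) (h₂.of_eq rfl rfl ?_ ?_),
        by simpa using hi₂, by simp, fun a ha b hb => ?_, fun b hb => ?_⟩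
      · rw [Memory.setMat_mat_of_ne _ (by omega)]
      · rw [Memory.setMat_mat_of_ne _ (by omega), h₂.mat_one]
      · rw [Memory.setReg_mat, Memory.setMat_mat_self, if_neg (by omega)]
        exact hm₂ a ha b hb
      · rw [Memory.setReg_mat, Memory.setMat_mat_self]
        split_ifs with hbj
        · rw [hbj.2]
        · exact hc₂ b (by omega)
    · rintro s₂ ⟨h₂, hi₂, -, hm₂, hc₂⟩
      refine ⟨hi₂, h₂.setReg le_rfl, by simp, fun a ha b hb => ?_⟩
      rcases Nat.lt_succ_iff_lt_or_eq.1 ha with h | rfl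
      · exact hm₂ a h b hb
      · exact hc₂ b hb
  · exact fun s' hs' u v => hs'.2.2 u u.isLt v v.isLt

/-! ### Polynomial bounds -/

/-- The function `f` is given by a polynomial with natural coefficients. -/
def IsPolynomial (f : ℕ → ℕ) : Prop := ∃ p : Polynomial ℕ, ∀ n, f n = p.eval n

theorem IsPolynomial.const (c : ℕ) : IsPolynomial fun _ => c := ⟨Polynomial.C c, by simp⟩

theorem IsPolynomial.id : IsPolynomial fun n => n := ⟨Polynomial.X, by simp⟩

theorem IsPolynomial.add {f g : ℕ → ℕ} (hf : IsPolynomial f) (hg : IsPolynomial g) :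
    IsPolynomial fun n => f n + g n := by
  obtain ⟨p, hp⟩ := hf
  obtain ⟨q, hq⟩ := hg
  exact ⟨p + q, fun n => by simp [hp, hq]⟩

theorem IsPolynomial.mul {f g : ℕ → ℕ} (hf : IsPolynomial f) (hg : IsPolynomial g) :
    IsPolynomial fun n => f n * g n := by
  obtain ⟨p, hp⟩ := hf
  obtain ⟨q, hq⟩ := hg
  exact ⟨p * q, fun n => by simp [hp, hq]⟩

theorem isPolynomial_forLoop {f : ℕ → ℕ} (hf : IsPolynomial f) :
    IsPolynomial fun n => n * (f n + 8) + 6 :=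
  (IsPolynomial.id.mul (hf.add (.const 8))).add (.const 6)

theorem isPolynomial_distTime : IsPolynomial distTime :=
  (isPolynomial_forLoop (.const 4)).add ((IsPolynomial.const 4).add
    ((isPolynomial_forLoop (isPolynomial_forLoop
      ((IsPolynomial.const 8).add (isPolynomial_forLoop (.const 18))))).add (.const 8)))

theorem isPolynomial_addEdgeTime : IsPolynomial addEdgeTime :=
  (IsPolynomial.const 4).add ((IsPolynomial.const 2).add
    (isPolynomial_distTime.add (.const (2 + 8))))

theorem isPolynomial_greedyTime : IsPolynomial greedyTime :=
  isPolynomial_forLoop (isPolynomial_forLoop isPolynomial_addEdgeTime)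

theorem isPolynomial_breakCycleTime : IsPolynomial breakCycleTime :=
  (IsPolynomial.const 4).add ((IsPolynomial.const 6).add ((IsPolynomial.const 8).add
    ((IsPolynomial.const 2).add ((IsPolynomial.const 2).add ((IsPolynomial.const 2).add
      (isPolynomial_distTime.add ((IsPolynomial.const 2).add
        (isPolynomial_greedyTime.add (.const 8)))))))))

theorem isPolynomial_spannerTime : IsPolynomial spannerTime :=
  (isPolynomial_forLoop (isPolynomial_forLoop
    (isPolynomial_forLoop isPolynomial_breakCycleTime))).add
    (isPolynomial_forLoop (isPolynomial_forLoop (.const 6)))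

end RAM

/-! ### Minimum spanners and the main theorem -/

open SimpleGraph in
theorem exists_isMinSpanner {V : Type*} [Finite V] {k : ℕ} (hk : k ≠ 0) (G : SimpleGraph V) :
    ∃ M : SimpleGraph V, IsMinSpanner k G M := by
  have hG : {M | IsSpanner k G M}.Nonempty := ⟨G, isSpanner_of_adj hk le_rfl fun x y h => by
    rw [edist_eq_one_iff_adj.2 h]
    exact_mod_cast Nat.one_le_iff_ne_zero.2 hk⟩
  obtain ⟨M, hM, hmin⟩ := Set.exists_min_image _ (fun M : SimpleGraph V => M.edgeSet.ncard)
    (Set.toFinite _) hG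
  exact ⟨M, hM, hmin⟩

theorem theorem1p10 :
    ∃ (C : ℝ) (N : ℕ),
      -- the polynomial-time algorithm
      (∃ (A : RAM.Prog) (p : Polynomial ℕ),
        ∀ (n k : ℕ) (G H : SimpleGraph (Fin n)),
          ∃ (t : ℕ) (s : RAM.Memory),
            RAM.Exec A (RAM.input n k G H) t s ∧ t ≤ p.eval n ∧
            (N ≤ n → 4 / 7 * (n : ℝ) + C < (k : ℝ) → G.Connected → IsSpanner k G H →
              ∃ R : SimpleGraph (Fin n),
                RAM.Outputs s R ∧
                IsSpanner k G R ∧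
                ((k + 2 : ℕ) : ℕ∞) ≤ R.egirth ∧
                (R.edgeSet.ncard : ℤ) - n ≤ 2 * ((H.edgeSet.ncard : ℤ) - n) + 1 ∧
                Relation.ReflTransGen (GirthStep k G) H R)) ∧
      -- the approximation guarantee for pairs
      (∃ β : ℝ, 0 ≤ β ∧
        ∀ n k : ℕ, N ≤ n → 4 / 7 * (n : ℝ) + C < (k : ℝ) → ApproxGood n k 2 β) := by
  have hbound : ∀ n k : ℕ, 4 / 7 * (n : ℝ) + 0 < (k : ℝ) → 4 * n < 7 * k := by
    intro n k h
    have : (4 * n : ℝ) < 7 * k := by linarith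
    exact_mod_cast this
  have hcard : ∀ {n k : ℕ} {G H R : SimpleGraph (Fin n)}, G.Connected → IsSpanner k G H →
      Relation.ReflTransGen (GirthStep k G) H R →
      R.edgeSet.ncard + n ≤ 2 * H.edgeSet.ncard + 1 := by
    intro n k G H R hG hH hR
    simpa using ncard_edgeSet_le_of_girthSteps (hH.connected hG) hR
  -- With `C = 0` the hypothesis reads `7k > 4n`, which suffices for every `n`; `β = 1` is the
  -- additive term of the edge count.
  refine ⟨0, 0, ?_, 1, zero_le_one, ?_⟩
  · obtain ⟨p, hp⟩ := RAM.isPolynomial_spannerTime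
    refine ⟨RAM.spannerProg, p, fun n k G H => ?_⟩
    obtain ⟨t, s, he, ht, hs⟩ := RAM.runs_spannerProg n k G H
    refine ⟨t, s, he, hp n ▸ ht, fun _ hk hG hH => ?_⟩
    obtain ⟨hsteps, hspan, hgirth⟩ := breakCycles_spec (hbound n k hk) hG hH
    refine ⟨_, hs, hspan, hgirth, ?_, hsteps⟩
    have := hcard hG hH hsteps
    omega
  · intro n k _ hk G hG
    have hk' := hbound n k hk
    -- The procedure is started from one minimum spanner `M₀`; the bound passes to any other `M`
    -- because `M₀` has at most as many edges.
    obtain ⟨M₀, hM₀, hmin⟩ := exists_isMinSpanner (k := k) (by omega) G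
    obtain ⟨hsteps, hspan, hgirth⟩ := breakCycles_spec hk' hG hM₀
    refine ⟨_, hspan, hgirth, fun M hM => ?_⟩
    have h1 := hcard hG hM₀ hsteps
    have h2 := hmin M hM.1
    have h3 : ((breakCycles k G M₀).edgeSet.ncard : ℝ) + n ≤ 2 * M.edgeSet.ncard + 1 := by
      exact_mod_cast h1.trans (by omega)
    linarith
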